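/- Let $C$ be a regular, geometrically integral, projective (equivalently, proper) curve over a finite field $\mathbb F_q$ with $q$ elements (of any genus; in particular of genus $g\ge 2$). A vector bundle $V$ of rank $r$ on $C$ is called semi-stable if its pull-back $\bar V$ to $C_{\overline{\mathbb F}_q}$ satisfies $d(V')/r(V')\le d(\bar V)/r(\bar V)$ for every proper subbundle $0\ne V'\subsetneq \bar V$, where $d$ and $r$ denote degree and rank. For $r\ge 1$ the rank $r$ non-abelian zeta function of $C$ is $$\zeta_{C,r,\mathbb F_q}(s)=\sum_{V}\frac{q^{h^0(C,V)}-1}{\#\mathrm{Aut}(V)}\,(q^{-s})^{d(V)},$$ where $V$ runs over all isomorphism classes of semi-stable vector bundles on $C$ (defined over $\mathbb F_q$) of rank $r$ and degree $d(V)\ge 0$, and $h^0(C,V)=\dim_{\mathbb F_q}H^0(C,V)$. The Artin zeta function of $C$ is $$\zeta_C(s)=\sum_{D\ge 0}\frac1{N(D)^{s}},$$ where $D=\sum_P n_P P$ runs over all effective divisors of $C$, and $N(D)=q^{d(D)}$ with $d(D)=\sum_P n_P\,d(P)$, $d(P)=[\kappa(P):\mathbb F_q]$. Then, for every $s\in\mathbb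 C$ with $\mathrm{Re}(s)>1$, the series defining $\zeta_{C,1,\mathbb F_q}(s)$ and $\zeta_C(s)$ both converge absolutely, and $$\zeta_{C,1,\mathbb F_q}(s)=\zeta_C(s).$$ -/

import Mathlib

open CategoryTheory AlgebraicGeometry

universe u

noncomputable section

namespace CurveZeta

/-! ### Vector bundles -/

section Bundles

variable {X : Scheme.{u}}

/-- The sections `e₁, …, e_r ∈ Γ(V, U)` form a frame of `V` on `U`: the induced map of sheaves
`𝒪_U^r → V|_U` is an isomorphism, i.e. it is bijective on sections over every open `W ⊆ U`. -/
def IsFrame (V : X.Modules) (U : X.Opens) {r : ℕ} (e : Fin r → Γ(V, U)) : Prop :=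
  ∀ (W : X.Opens) (h : W ≤ U), Function.Bijective
    (fun a : Fin r → Γ(X, W) => ∑ i, a i • V.presheaf.map (homOfLE h).op (e i))

/-- `V` is a vector bundle of rank `r`: an `𝒪_X`-module that is locally free of rank `r`. -/
def IsVectorBundle (V : X.Modules) (r : ℕ) : Prop :=
  ∀ x : X, ∃ (U : X.Opens) (_ : x ∈ U) (e : Fin r → Γ(V, U)), IsFrame V U e

/-- On an integral scheme, let `e` be a rational frame of `V` (a frame on an open set `U` that
contains the generic point). `HasOrderAt V hU e x n` says that the rational section
`e₁ ∧ ⋯ ∧ e_r` of the line bundle `det V` has order `n` at the point `x`: if `f` is a frame of `V`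
near `x` and `e = A f`, then `n` is the order of vanishing of `det A` at `x`. -/
def HasOrderAt [IsIntegral X] [IsLocallyNoetherian X] (V : X.Modules) {U : X.Opens}
    (hU : genericPoint X ∈ U) {r : ℕ} (e : Fin r → Γ(V, U)) (x : X) (n : ℤ) : Prop :=
  ∃ (W : X.Opens) (_ : x ∈ W) (hW : genericPoint X ∈ W) (f : Fin r → Γ(V, W))
    (A : Matrix (Fin r) (Fin r) Γ(X, U ⊓ W)),
    IsFrame V W f ∧
    (∀ i, V.presheaf.map (homOfLE (inf_le_left : U ⊓ W ≤ U)).op (e i) =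
      ∑ j, A i j • V.presheaf.map (homOfLE (inf_le_right : U ⊓ W ≤ W)).op (f j)) ∧
    Scheme.ord (X.presheaf.germ (U ⊓ W) (genericPoint X) ⟨hU, hW⟩ A.det) x = n

end Bundles

/-! ### Curves over a field -/

section Curves

variable {k : Type u} [Field k]

/-- `f : X ⟶ Spec k` is a curve over `k` that is proper (equivalently, for curves, projective),
geometrically integral and regular. -/
class IsCurve {X : Scheme.{u}} (f : X ⟶ Spec (.of k)) : Prop extends
    IsProper f, GeometricallyIntegral f where
  isRegularLocalRing_stalk : ∀ x : X, IsRegularLocalRing (X.presheaf.stalk x)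
  topologicalKrullDim_eq_one : topologicalKrullDim X = 1

variable {X : Scheme.{u}} (f : X ⟶ Spec (.of k))

theorem isIntegral_of_geometricallyIntegral [GeometricallyIntegral f] : IsIntegral X :=
  GeometricallyIntegral.isIntegral_of_isLocallyNoetherian f

theorem isLocallyNoetherian_of_locallyOfFiniteType [LocallyOfFiniteType f] :
    IsLocallyNoetherian X :=
  LocallyOfFiniteType.isLocallyNoetherian f

/-- `V` has degree `d`: for some rational frame `e` of `V`, the divisor of the rational section
`e₁ ∧ ⋯ ∧ e_r` of `det V` has degree `d = ∑_x ord_x · [κ(x) : k]`. -/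
def HasDegree [LocallyOfFiniteType f] [GeometricallyIntegral f] (V : X.Modules) (d : ℤ) : Prop :=
  haveI := isIntegral_of_geometricallyIntegral f
  haveI := isLocallyNoetherian_of_locallyOfFiniteType f
  ∃ (r : ℕ) (U : X.Opens) (hU : genericPoint X ∈ U) (e : Fin r → Γ(V, U)) (n : X → ℤ),
    IsFrame V U e ∧ (∀ x, HasOrderAt V hU e x (n x)) ∧ d = ∑ᶠ x, n x * (f.residueDegree x : ℤ)

open Classical in
/-- The degree `d(V)` of a vector bundle `V` on a curve over `k`. -/
def degree [LocallyOfFiniteType f] [GeometricallyIntegral f] (V : X.Modules) : ℤ :=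
  if h : ∃ d, HasDegree f V d then h.choose else 0

/-- A rank `r` vector bundle `V` is semi-stable: `μ(V') ≤ μ(V)` for every proper subbundle
`V' ⊂ V` (`V'` and `V / V'` are vector bundles, and `0 < rk V' < r`), where `μ = degree / rank`. -/
def IsSemistable [LocallyOfFiniteType f] [GeometricallyIntegral f] (V : X.Modules) (r : ℕ) :
    Prop :=
  ∀ (V' : X.Modules) (i : V' ⟶ V) (r' : ℕ), Mono i → 0 < r' → r' < r →
    IsVectorBundle V' r' → IsVectorBundle (Limits.cokernel i) (r - r') →
    (degree f V' : ℚ) / r' ≤ (degree f V : ℚ) / r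

variable (k) in
/-- The morphism `Spec k̄ ⟶ Spec k`. -/
def specAlgClosure : Spec (.of (AlgebraicClosure k)) ⟶ Spec (.of k) :=
  Spec.map (CommRingCat.ofHom (algebraMap k (AlgebraicClosure k)))

/-- `V` is a vector bundle of rank `r` on `X` (so it is defined over `k`) whose pull-back to
`X_{k̄}` is semi-stable. -/
def IsGeometricallySemistable [LocallyOfFiniteType f] [GeometricallyIntegral f] (V : X.Modules)
    (r : ℕ) : Prop :=
  IsVectorBundle V r ∧
    IsSemistable (Limits.pullback.snd f (specAlgClosure k))
      ((Scheme.Modules.pullback (Limits.pullback.fst f (specAlgClosure k))).obj V) r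

/-- `h⁰(X, V) = dim_k Γ(X, V)`. -/
def h0 (V : X.Modules) : ℕ :=
  letI : Module k Γ(V, ⊤) :=
    Module.compHom Γ(V, ⊤) ((Scheme.ΓSpecIso (.of k)).inv ≫ f.appTop).hom
  Module.finrank k Γ(V, ⊤)

/-! ### The two zeta functions (for `k` a finite field, with `q = #k` elements) -/

/-- The set of isomorphism classes of `k`-rational (geometrically) semi-stable vector bundles of
rank `r` and degree `d ≥ 0` on `X`. -/
def semistableClasses [LocallyOfFiniteType f] [GeometricallyIntegral f] (r : ℕ) :
    Set (Quotient (isIsomorphicSetoid X.Modules)) :=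
  {c | IsGeometricallySemistable f c.out r ∧ 0 ≤ degree f c.out}

/-- `(q^{h⁰(V)} - 1) / #Aut(V) · (q^{-s})^{d(V)}`. -/
def nonabelianZetaTerm [LocallyOfFiniteType f] [GeometricallyIntegral f] (s : ℂ)
    (V : X.Modules) : ℂ :=
  ((Nat.card k : ℂ) ^ h0 f V - 1) / (Nat.card (Aut V) : ℂ) *
    ((Nat.card k : ℂ) ^ (-s)) ^ degree f V

/-- The rank `r` non-abelian zeta function. -/
def nonabelianZeta [LocallyOfFiniteType f] [GeometricallyIntegral f] (r : ℕ) (s : ℂ) : ℂ :=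
  ∑' c : semistableClasses f r, nonabelianZetaTerm f s c.1.out

variable (X) in
/-- Effective divisors `∑_P n_P P`, with `P` running over the closed points. -/
abbrev EffectiveDivisor : Type u := {x : X // IsClosed {x}} →₀ ℕ

/-- `d(∑ n_P P) = ∑ n_P d(P)`, where `d(P) = [κ(P) : k]`. -/
def divisorDegree (D : EffectiveDivisor X) : ℕ := D.sum fun P n => n * f.residueDegree P.1

/-- `N(D) = q^{d(D)}`. -/
def divisorNorm (D : EffectiveDivisor X) : ℕ := Nat.card k ^ divisorDegree f D

/-- `1 / N(D)^s`. -/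
def artinZetaTerm (s : ℂ) (D : EffectiveDivisor X) : ℂ := 1 / (divisorNorm f D : ℂ) ^ s

/-- The Artin zeta function. -/
def artinZeta (s : ℂ) : ℂ := ∑' D : EffectiveDivisor X, artinZetaTerm f s D

end Curves

end CurveZeta

end

noncomputable section

namespace CurveZeta

/-! ### Families of discrete valuations -/

/-! In rank one semi-stability is vacuous, so the left-hand series runs over all line bundles of
nonnegative degree. Group the effective divisors `E` by the isomorphism class of `𝒪(E)`. If `M ≅
𝒪(D)`, the `E` with `𝒪(E) ≅ M` are the divisors `D + div φ` with `φ` a nonzero element of `L(D) ≅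
H⁰(M)`. Such a `φ` is determined by `E` up to functions without zeros and poles, and these functions
are the automorphisms of `M`. So the class of `M` contains `(q^h⁰ - 1) / #Aut M` effective divisors
(`card_linearSystem_mul`, `card_aut`), all of degree `d(M)`, and the Artin terms over this class add
up to the term of `M` (`tsum_fiber_artinZetaTerm`). Absolute convergence of the Artin series then
gives everything else.

Two facts about curves are needed. First, principal divisors have degree zero (`divDeg_div`), so
that the degree of `M` can be read off from any divisor. Second, there are `O(qⁿ)` points of degree
`n` (`exists_card_le`), which gives convergence for `Re s > 1` by comparison with an Euler product.
Riemann-Roch is not used: both facts follow from the bound `dim L(D) ≤ dim L(0) + deg D` and from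
weak approximation. They are proved for a field with a family of valuations (`IsProperFamily`), and
`isProperFamily_curveOrd` supplies this family for a curve. `RationalTrivialization` is the
dictionary between line bundles and divisors. -/

/-- A family of discrete valuations on a field `K`, trivial on the subfield `k`, such that a nonzero
element of `K` has only finitely many zeros and poles. -/
structure OrdFamily (k K ι : Type*) [Field k] [Field K] [Algebra k K] where
  ord : ι → K → ℤ
  ord_mul : ∀ P {x y : K}, x ≠ 0 → y ≠ 0 → ord P (x * y) = ord P x + ord P y
  ord_add : ∀ P {x y : K}, x ≠ 0 → y ≠ 0 → x + y ≠ 0 → min (ord P x) (ord P y) ≤ ord P (x + y)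
  ord_algebraMap : ∀ P {c : k}, c ≠ 0 → ord P (algebraMap k K c) = 0
  finite_support : ∀ {x : K}, x ≠ 0 → {P | ord P x ≠ 0}.Finite

namespace OrdFamily

variable {k K ι : Type*} [Field k] [Field K] [Algebra k K] (v : OrdFamily k K ι)

lemma ord_one (P : ι) : v.ord P 1 = 0 := by
  simpa using v.ord_algebraMap P (one_ne_zero (α := k))

lemma ord_neg (P : ι) (x : K) : v.ord P (-x) = v.ord P x := by
  by_cases hx : x = 0
  · simp [hx]
  have h : v.ord P (-1) = 0 := by
    simpa using v.ord_algebraMap P (neg_ne_zero.mpr (one_ne_zero (α := k)))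
  have := v.ord_mul P (neg_ne_zero.mpr (one_ne_zero (α := K))) hx
  simpa [h] using this

lemma ord_inv (P : ι) {x : K} (hx : x ≠ 0) : v.ord P x⁻¹ = -v.ord P x := by
  have := v.ord_mul P hx (inv_ne_zero hx)
  rw [mul_inv_cancel₀ hx, ord_one] at this
  omega

lemma ord_pow (P : ι) {x : K} (hx : x ≠ 0) (n : ℕ) : v.ord P (x ^ n) = n * v.ord P x := by
  induction n with
  | zero => simp [ord_one]
  | succ n ih => rw [pow_succ, v.ord_mul P (pow_ne_zero n hx) hx, ih]; push_cast; ring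

lemma ord_zpow (P : ι) {x : K} (hx : x ≠ 0) (n : ℤ) : v.ord P (x ^ n) = n * v.ord P x := by
  cases n with
  | ofNat n => simpa using v.ord_pow P hx n
  | negSucc n =>
    rw [zpow_negSucc, v.ord_inv P (pow_ne_zero _ hx), ord_pow v P hx, Int.negSucc_eq]
    push_cast; ring

lemma add_ne_zero_of_ord_lt (P : ι) {x y : K} (h : v.ord P x < v.ord P y) : x + y ≠ 0 := by
  intro h0
  rw [← neg_eq_of_add_eq_zero_right h0, ord_neg] at h
  exact lt_irrefl _ h

lemma ord_add_eq_of_lt (P : ι) {x y : K} (hx : x ≠ 0) (hy : y ≠ 0) (h : v.ord P x < v.ord P y) :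
    v.ord P (x + y) = v.ord P x := by
  have hxy := v.add_ne_zero_of_ord_lt P h
  refine le_antisymm ?_ ((min_eq_left h.le).symm.le.trans (v.ord_add P hx hy hxy))
  have := v.ord_add P hxy (neg_ne_zero.mpr hy) (by simpa using hx)
  rw [add_neg_cancel_right, ord_neg] at this
  by_contra! hlt
  exact absurd this (not_le.mpr (lt_min hlt h))

/-- The elements of `K` whose order at each `P ∈ S` is at least `n P`. -/
def above (S : Set ι) (n : ι → ℤ) : Submodule k K where
  -- The guard `x ≠ 0` is essential: `ord P 0` is an unconstrained integer.
  carrier := {x | x ≠ 0 → ∀ P ∈ S, n P ≤ v.ord P x}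
  zero_mem' := fun h => absurd rfl h
  add_mem' := by
    intro x y hx hy hxy P hP
    by_cases h0 : x = 0
    · subst h0; rw [zero_add] at hxy ⊢; exact hy hxy P hP
    by_cases h1 : y = 0
    · subst h1; rw [add_zero] at hxy ⊢; exact hx hxy P hP
    exact (le_min (hx h0 P hP) (hy h1 P hP)).trans (v.ord_add P h0 h1 hxy)
  smul_mem' := by
    intro c x hx hcx P hP
    rw [Algebra.smul_def] at hcx ⊢
    have hc : c ≠ 0 := by rintro rfl; simp at hcx
    have h0 : x ≠ 0 := right_ne_zero_of_mul hcx
    rw [v.ord_mul P (left_ne_zero_of_mul hcx) h0, v.ord_algebraMap P hc, zero_add]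
    exact hx h0 P hP

variable {v}

lemma mem_above {S : Set ι} {n : ι → ℤ} {x : K} :
    x ∈ v.above S n ↔ (x ≠ 0 → ∀ P ∈ S, n P ≤ v.ord P x) := Iff.rfl

lemma above_mono {S T : Set ι} {m n : ι → ℤ} (hST : T ⊆ S) (h : ∀ P ∈ T, m P ≤ n P) :
    v.above S n ≤ v.above T m :=
  fun _ hx h0 P hP => (h P hP).trans (hx h0 P (hST hP))

lemma mul_mem_above {S : Set ι} {m n : ι → ℤ} {x y : K} (hx : x ∈ v.above S m)
    (hy : y ∈ v.above S n) : x * y ∈ v.above S (m + n) := by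
  intro h P hP
  rw [v.ord_mul P (left_ne_zero_of_mul h) (right_ne_zero_of_mul h)]
  exact add_le_add (hx (left_ne_zero_of_mul h) P hP) (hy (right_ne_zero_of_mul h) P hP)

lemma one_mem_above (S : Set ι) : (1 : K) ∈ v.above S 0 :=
  fun _ P _ => (v.ord_one P).ge

lemma pow_mem_above {S : Set ι} {n : ι → ℤ} {x : K} (hx : x ∈ v.above S n) (j : ℕ) :
    x ^ j ∈ v.above S (j • n) := by
  induction j with
  | zero => simpa using one_mem_above S
  | succ j ih => rw [pow_succ, succ_nsmul]; exact mul_mem_above ih hx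

lemma mem_above_single {P : ι} {n : ι → ℤ} {x : K} :
    x ∈ v.above {P} n ↔ (x ≠ 0 → n P ≤ v.ord P x) := by
  simp [mem_above]

variable (v)

/-- The divisor of zeros and poles of a nonzero element. -/
def div (x : K) (hx : x ≠ 0) : ι →₀ ℤ :=
  Finsupp.ofSupportFinite (fun P => v.ord P x) (v.finite_support hx)

@[simp]
lemma div_apply (x : K) (hx : x ≠ 0) (P : ι) : v.div x hx P = v.ord P x := rfl

end OrdFamily

/-- The degree of a divisor, where the points `P` have degrees `d P`. -/
def divDeg {ι : Type*} (d : ι → ℕ) : (ι →₀ ℤ) →+ ℤ :=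
  Finsupp.liftAddHom fun P => AddMonoidHom.mulRight (d P : ℤ)

@[simp]
lemma divDeg_single {ι : Type*} (d : ι → ℕ) (P : ι) (n : ℤ) :
    divDeg d (Finsupp.single P n) = n * d P := by
  simp [divDeg]

lemma divDeg_apply {ι : Type*} (d : ι → ℕ) (D : ι →₀ ℤ) : divDeg d D = D.sum fun P n => n * d P := by
  simp [divDeg, Finsupp.liftAddHom_apply]

lemma divDeg_nonneg {ι : Type*} (d : ι → ℕ) {D : ι →₀ ℤ} (hD : 0 ≤ D) : 0 ≤ divDeg d D := by
  rw [divDeg_apply]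
  exact Finset.sum_nonneg fun P _ => mul_nonneg (hD P) (Int.natCast_nonneg _)

lemma divDeg_mono {ι : Type*} (d : ι → ℕ) {D E : ι →₀ ℤ} (h : D ≤ E) : divDeg d D ≤ divDeg d E := by
  have := divDeg_nonneg d (sub_nonneg.mpr h)
  rw [map_sub] at this
  omega

/-- Induction over effective divisors. -/
lemma effective_induction {ι : Type*} {motive : (ι →₀ ℤ) → Prop} (zero : motive 0)
    (add_single : ∀ D P, 0 ≤ D → motive D → motive (D + Finsupp.single P 1)) (D : ι →₀ ℤ)
    (hD : 0 ≤ D) : motive D := by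
  -- The induction is on the total multiplicity, that is, the degree with all points given degree
  -- one.
  induction h : divDeg (fun _ => 1) D using Int.strongRec (m := 0) generalizing D with
  | lt n hn => have := divDeg_nonneg (fun _ => 1) hD; omega
  | ge n hn ih =>
    by_cases h0 : D = 0
    · exact h0 ▸ zero
    obtain ⟨P, hP⟩ := Finsupp.ne_iff.mp h0
    have hP' : 1 ≤ D P := by
      have := hD P
      simp only [Finsupp.coe_zero, Pi.zero_apply] at this hP
      omega
    have hE : 0 ≤ D - Finsupp.single P 1 := by
      intro Q
      by_cases hQ : P = Q
      · subst hQ; simpa using hP'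
      · simpa [Finsupp.single_apply, hQ] using hD Q
    have := add_single _ P hE (ih _ (by rw [← h, map_sub]; simp) _ hE rfl)
    simpa using this

namespace OrdFamily

variable {k K ι : Type*} [Field k] [Field K] [Algebra k K]

/-- The family `v` behaves like the family of closed points of a proper regular curve, with residue
degrees `d`. -/
structure IsProperFamily (v : OrdFamily k K ι) (d : ι → ℕ) : Prop where
  deg_pos : ∀ P, 0 < d P
  exists_ord_eq_one : ∀ P, ∃ x : K, x ≠ 0 ∧ v.ord P x = 1
  -- Reduction modulo the maximal ideal. Only the linear structure of the residue field matters, so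
  -- it is replaced by a coordinate space.
  exists_residue : ∀ P, ∃ r : v.above {P} 0 →ₗ[k] (Fin (d P) → k),
    Function.Surjective r ∧ ∀ x, r x = 0 ↔ (x : K) ∈ v.above {P} 1
  -- The next field encodes separatedness, the last one finiteness of global functions.
  exists_separating : ∀ P Q, P ≠ Q → ∃ x : K, x ≠ 0 ∧ v.ord P x < 0 ∧ 0 ≤ v.ord Q x
  finite : Module.Finite k (v.above Set.univ 0)

/-- The Riemann-Roch space `L(D)`. -/
def space (v : OrdFamily k K ι) (D : ι →₀ ℤ) : Submodule k K := v.above Set.univ (-⇑D)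

lemma mem_space {v : OrdFamily k K ι} {D : ι →₀ ℤ} {x : K} :
    x ∈ v.space D ↔ (x ≠ 0 → ∀ P, -D P ≤ v.ord P x) := by
  simp [space, mem_above]

lemma space_zero {v : OrdFamily k K ι} : v.space 0 = v.above Set.univ 0 := by
  ext x; simp [mem_space, mem_above]

lemma space_mono {v : OrdFamily k K ι} {D E : ι →₀ ℤ} (h : D ≤ E) : v.space D ≤ v.space E :=
  fun _ hx => mem_space.mpr fun h0 P => (neg_le_neg (h P)).trans (mem_space.mp hx h0 P)

lemma mul_mem_space {v : OrdFamily k K ι} {D E : ι →₀ ℤ} {x y : K} (hx : x ∈ v.space D)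
    (hy : y ∈ v.space E) : x * y ∈ v.space (D + E) := by
  have := mul_mem_above hx hy
  rw [space, Finsupp.coe_add, neg_add]
  exact this

end OrdFamily

/-- If `h : B → kᵈ` has kernel contained in the finite-dimensional `A`, then `B` is
finite-dimensional, of dimension at most `dim A + d`. -/
lemma finite_and_finrank_le_of_ker_le {k K : Type*} [Field k] [AddCommGroup K] [Module k K]
    {A B : Submodule k K} [Module.Finite k A] {d : ℕ} (h : B →ₗ[k] (Fin d → k))
    (hker : ∀ x, h x = 0 → (x : K) ∈ A) :
    Module.Finite k B ∧ Module.finrank k B ≤ Module.finrank k A + d := by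
  let g : LinearMap.ker h →ₗ[k] A :=
    (B.subtype ∘ₗ (LinearMap.ker h).subtype).codRestrict A fun x => hker _ x.2
  have hg : Function.Injective g := fun x y hxy =>
    Subtype.ext (Subtype.ext (congrArg (Subtype.val : A → K) hxy))
  have : Module.Finite k (LinearMap.ker h) := Module.Finite.of_injective g hg
  have hB : Module.Finite k B := by
    have : Module.Finite k (B ⧸ LinearMap.ker h) := Module.Finite.equiv h.quotKerEquivRange.symm
    exact Module.Finite.of_submodule_quotient (LinearMap.ker h)
  refine ⟨hB, ?_⟩
  have h1 := h.finrank_range_add_finrank_ker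
  have h2 := LinearMap.finrank_le_finrank_of_injective hg
  have h3 := Submodule.finrank_le (LinearMap.range h)
  simp only [Module.finrank_fintype_fun_eq_card, Fintype.card_fin] at h3
  omega

/-! ### Finiteness of the Riemann-Roch spaces -/

namespace OrdFamily.IsProperFamily

variable {k K ι : Type*} [Field k] [Field K] [Algebra k K] {v : OrdFamily k K ι} {d : ι → ℕ}
  (hv : v.IsProperFamily d)
include hv

lemma exists_ord_eq (P : ι) (n : ℤ) : ∃ x : K, x ≠ 0 ∧ v.ord P x = n := by
  obtain ⟨x, hx, h⟩ := hv.exists_ord_eq_one P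
  exact ⟨x ^ n, zpow_ne_zero n hx, by rw [v.ord_zpow P hx, h, mul_one]⟩

/-- Multiplication by an element of order `D P + 1` at `P` makes the functions in `L(D + P)` regular
at `P`; those whose residue then vanishes lie in `L(D)`. -/
lemma finite_space_add_single (D : ι →₀ ℤ) (P : ι) [Module.Finite k (v.space D)] :
    Module.Finite k (v.space (D + Finsupp.single P 1)) ∧
      Module.finrank k (v.space (D + Finsupp.single P 1)) ≤ Module.finrank k (v.space D) + d P := by
  obtain ⟨c, hc, hcP⟩ := hv.exists_ord_eq P (D P + 1)
  obtain ⟨r, -, hr⟩ := hv.exists_residue P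
  have hmem : ∀ x : v.space (D + Finsupp.single P 1), c * (x : K) ∈ v.above {P} 0 := by
    intro x
    rw [mem_above_single]
    intro h0
    have := mem_space.mp x.2 (right_ne_zero_of_mul h0) P
    rw [v.ord_mul P hc (right_ne_zero_of_mul h0), hcP]
    simp only [Finsupp.coe_add, Pi.add_apply, Finsupp.single_eq_same] at this
    simp only [Pi.zero_apply]; omega
  let g := (LinearMap.mulLeft k c ∘ₗ (v.space (D + Finsupp.single P 1)).subtype).codRestrict
    (v.above {P} 0) hmem
  refine finite_and_finrank_le_of_ker_le (r ∘ₗ g) fun x hx => ?_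
  have h1 := mem_above_single.mp ((hr _).mp hx)
  rw [mem_space]
  intro h0 Q
  by_cases hQ : P = Q
  · subst hQ
    have h2 : (1 : ℤ) ≤ v.ord P (c * x) := h1 (mul_ne_zero hc h0)
    rw [v.ord_mul P hc h0, hcP] at h2
    omega
  · have := mem_space.mp x.2 h0 Q
    simpa [Finsupp.single_apply, hQ] using this

lemma finite_space_of_nonneg (D : ι →₀ ℤ) (hD : 0 ≤ D) :
    Module.Finite k (v.space D) ∧
      (Module.finrank k (v.space D) : ℤ) ≤ Module.finrank k (v.space 0) + divDeg d D := by
  refine effective_induction (motive := fun D => Module.Finite k (v.space D) ∧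
    (Module.finrank k (v.space D) : ℤ) ≤ Module.finrank k (v.space 0) + divDeg d D) ?_ ?_ D hD
  · refine ⟨?_, by simp⟩
    rw [space_zero]
    exact hv.finite
  · intro D P hD ih
    have := ih.1
    obtain ⟨h1, h2⟩ := hv.finite_space_add_single D P
    refine ⟨h1, ?_⟩
    rw [map_add, divDeg_single]
    have := ih.2
    have h2' : (Module.finrank k (v.space (D + Finsupp.single P 1)) : ℤ) ≤
      Module.finrank k (v.space D) + d P := by exact_mod_cast h2
    linarith

lemma finite_space (D : ι →₀ ℤ) : Module.Finite k (v.space D) := by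
  have := (hv.finite_space_of_nonneg (D ⊔ 0) le_sup_right).1
  exact Module.Finite.of_injective (Submodule.inclusion (space_mono (v := v) (le_sup_left (b := 0))))
    (Submodule.inclusion_injective _)

/-! #### Weak approximation -/

/-- Induction on `S`. Given `z` for `S`, and `y` with a pole at `P` and a zero at the new point `R`,
the product `z ^ m * y` works if `z` is regular at `R`. If `z` has a pole at `R`, then `z ^ m` is
replaced by `z ^ m / (z ^ m + 1)`, which has order `0` at `P` and `R` and the order of `z ^ m` on
`S`. -/
lemma exists_pole_forall_zero (P : ι) (S : Finset ι) (hP : P ∉ S) :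
    ∃ z : K, z ≠ 0 ∧ v.ord P z < 0 ∧ ∀ Q ∈ S, 0 < v.ord Q z := by
  classical
  induction S using Finset.induction_on with
  | empty =>
    obtain ⟨z, hz, h⟩ := hv.exists_ord_eq P (-1)
    exact ⟨z, hz, by omega, by simp⟩
  | insert R S hR ih =>
    rw [Finset.mem_insert, not_or] at hP
    obtain ⟨z, hz, hzP, hzS⟩ := ih hP.2
    obtain ⟨y₁, hy₁, h₁P, h₁R⟩ := hv.exists_separating P R hP.1
    obtain ⟨y₂, hy₂, h₂R, h₂P⟩ := hv.exists_separating R P (Ne.symm hP.1)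
    obtain ⟨y, hy, hyP, hyR⟩ : ∃ y : K, y ≠ 0 ∧ v.ord P y < 0 ∧ 0 < v.ord R y := by
      refine ⟨y₁ * y₂⁻¹, mul_ne_zero hy₁ (inv_ne_zero hy₂), ?_, ?_⟩ <;>
      · rw [v.ord_mul _ hy₁ (inv_ne_zero hy₂), v.ord_inv _ hy₂]; omega
    -- The zeros of `z ^ m` on `S` have to outweigh the poles of `y`.
    obtain ⟨m, hm0, hm⟩ : ∃ m : ℕ, 0 < m ∧ ∀ Q ∈ S, -v.ord Q y < m := by
      refine ⟨S.sup (fun Q => (-v.ord Q y).toNat) + 1, by omega, fun Q hQ => ?_⟩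
      have := Finset.le_sup (f := fun Q => (-v.ord Q y).toNat) hQ
      have h2 := Int.self_le_toNat (-v.ord Q y)
      push_cast
      omega
    have hmz : ∀ Q ∈ S, -v.ord Q y < m * v.ord Q z := fun Q hQ =>
      (hm Q hQ).trans_le (le_mul_of_one_le_right (by omega) (hzS Q hQ))
    have hzm := pow_ne_zero m hz
    rcases le_or_gt 0 (v.ord R z) with hRz | hRz
    · refine ⟨z ^ m * y, mul_ne_zero hzm hy, ?_, ?_⟩
      · rw [v.ord_mul P hzm hy, v.ord_pow P hz]
        have : (m : ℤ) * v.ord P z ≤ 0 := mul_nonpos_of_nonneg_of_nonpos (by omega) hzP.le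
        omega
      · intro Q hQ
        rw [v.ord_mul Q hzm hy, v.ord_pow Q hz]
        rcases Finset.mem_insert.mp hQ with rfl | hQ
        · have : 0 ≤ (m : ℤ) * v.ord Q z := mul_nonneg (by omega) hRz
          omega
        · have := hmz Q hQ; omega
    · have hpole : ∀ Q, v.ord Q z < 0 → z ^ m + 1 ≠ 0 ∧ v.ord Q (z ^ m + 1) = m * v.ord Q z := by
        intro Q hQ
        have h : v.ord Q (z ^ m) < v.ord Q 1 := by
          rw [v.ord_one, v.ord_pow Q hz]; exact mul_neg_of_pos_of_neg (by omega) hQ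
        exact ⟨v.add_ne_zero_of_ord_lt Q h, by
          rw [v.ord_add_eq_of_lt Q hzm one_ne_zero h, v.ord_pow Q hz]⟩
      have hne := (hpole P hzP).1
      refine ⟨z ^ m * (z ^ m + 1)⁻¹ * y, mul_ne_zero (mul_ne_zero hzm (inv_ne_zero hne)) hy, ?_, ?_⟩
      · rw [v.ord_mul P (mul_ne_zero hzm (inv_ne_zero hne)) hy, v.ord_mul P hzm (inv_ne_zero hne),
          v.ord_inv P hne, (hpole P hzP).2, v.ord_pow P hz]
        omega
      · intro Q hQ
        rw [v.ord_mul Q (mul_ne_zero hzm (inv_ne_zero hne)) hy, v.ord_mul Q hzm (inv_ne_zero hne),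
          v.ord_inv Q hne, v.ord_pow Q hz]
        rcases Finset.mem_insert.mp hQ with rfl | hQ
        · rw [(hpole Q hRz).2]; omega
        · have h : v.ord Q 1 < v.ord Q (z ^ m) := by
            rw [v.ord_one, v.ord_pow Q hz]; exact mul_pos (by omega) (hzS Q hQ)
          rw [add_comm (z ^ m) 1, v.ord_add_eq_of_lt Q one_ne_zero hzm h, v.ord_one]
          have := hmz Q hQ; omega

/-- Weak approximation: there is `e` close to `1` at `P` and close to `0` at the points of `S`. -/
lemma exists_approx (P : ι) (S : Finset ι) (hP : P ∉ S) (M : ℕ) :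
    ∃ e : K, e ≠ 0 ∧ v.ord P e = 0 ∧ ∀ Q ∈ S, (M : ℤ) ≤ v.ord Q e := by
  obtain ⟨z, hz, hzP, hzS⟩ := hv.exists_pole_forall_zero P S hP
  have hzm := pow_ne_zero (M + 1) hz
  have h : v.ord P (z ^ (M + 1)) < v.ord P 1 := by
    rw [v.ord_one, v.ord_pow P hz]; exact mul_neg_of_pos_of_neg (by omega) hzP
  have hne := v.add_ne_zero_of_ord_lt P h
  -- This quotient is close to `1` where `z` has a pole and close to `0` where `z` has a zero.
  refine ⟨z ^ (M + 1) * (z ^ (M + 1) + 1)⁻¹, mul_ne_zero hzm (inv_ne_zero hne), ?_, ?_⟩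
  · rw [v.ord_mul P hzm (inv_ne_zero hne), v.ord_inv P hne, v.ord_add_eq_of_lt P hzm one_ne_zero h]
    omega
  · intro Q hQ
    have h : v.ord Q 1 < v.ord Q (z ^ (M + 1)) := by
      rw [v.ord_one, v.ord_pow Q hz]; exact mul_pos (by omega) (hzS Q hQ)
    have h2 := hzS Q hQ
    rw [v.ord_mul Q hzm (inv_ne_zero hne), v.ord_inv Q hne, add_comm (z ^ (M + 1)) 1,
      v.ord_add_eq_of_lt Q one_ne_zero hzm h, v.ord_one, v.ord_pow Q hz]
    push_cast
    nlinarith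

end OrdFamily.IsProperFamily

/-! ### Principal divisors have degree zero -/

namespace OrdFamily

variable {k K ι : Type*} [Field k] [Field K] [Algebra k K] {v : OrdFamily k K ι}

lemma exists_le_space (U : Submodule k K) (hU : U.FG) : ∃ D : ι →₀ ℤ, 0 ≤ D ∧ U ≤ v.space D := by
  induction U, hU using Submodule.fg_induction with
  | singleton x =>
    by_cases hx : x = 0
    · exact ⟨0, le_rfl, by simp [hx]⟩
    refine ⟨(-v.div x hx) ⊔ 0, le_sup_right, ?_⟩
    rw [Submodule.span_singleton_le_iff_mem, mem_space]
    intro _ P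
    have : (-v.div x hx) P ≤ ((-v.div x hx) ⊔ 0) P := le_sup_left (α := ι →₀ ℤ) P
    simp only [Finsupp.coe_neg, Pi.neg_apply, div_apply] at this
    omega
  | sup U₁ U₂ _ _ ih₁ ih₂ =>
    obtain ⟨D₁, h₁, hU₁⟩ := ih₁
    obtain ⟨D₂, h₂, hU₂⟩ := ih₂
    exact ⟨D₁ ⊔ D₂, h₁.trans le_sup_left, sup_le (hU₁.trans (space_mono le_sup_left))
      (hU₂.trans (space_mono le_sup_right))⟩

/-- The product of a submodule with an element. -/
lemma finrank_map_mulLeft {x : K} (hx : x ≠ 0) (U : Submodule k K) :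
    Module.finrank k (U.map (LinearMap.mulLeft k x)) = Module.finrank k U :=
  (Submodule.equivMapOfInjective _ (mul_right_injective₀ hx) U).finrank_eq.symm

namespace IsProperFamily

variable {d : ι → ℕ} (hv : v.IsProperFamily d)
include hv

/-- A space of elements that are regular on `S`, of dimension `deg E`, in which only `0` vanishes to
order `E`. -/
lemma exists_complement (S : Finset ι) (E : ι →₀ ℤ) (hE : 0 ≤ E) (hES : E.support ⊆ S) :
    ∃ U : Submodule k K, Module.Finite k U ∧ (Module.finrank k U : ℤ) = divDeg d E ∧
      U ≤ v.above S 0 ∧ U ⊓ v.above S E = ⊥ := by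
  classical
  revert hES
  refine effective_induction (motive := fun E => E.support ⊆ S → ∃ U : Submodule k K,
    Module.Finite k U ∧ (Module.finrank k U : ℤ) = divDeg d E ∧
      U ≤ v.above S 0 ∧ U ⊓ v.above S E = ⊥) ?_ ?_ E hE
  · exact fun _ => ⟨⊥, inferInstance, by simp, bot_le, by simp⟩
  intro E P hE ih hES
  have hEP : ∀ Q, E Q ≤ (E + Finsupp.single P 1 : ι →₀ ℤ) Q := fun Q => by
    by_cases h : P = Q <;> simp [h]
  have hsupp : E.support ⊆ S := by
    intro Q hQ
    apply hES
    rw [Finsupp.mem_support_iff] at hQ ⊢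
    have := hEP Q; have := hE Q; simp only [Finsupp.coe_zero, Pi.zero_apply] at this; omega
  have hPS : P ∈ S := by
    apply hES
    rw [Finsupp.mem_support_iff]
    have := hE P
    simp only [Finsupp.coe_zero, Pi.zero_apply, Finsupp.coe_add, Pi.add_apply,
      Finsupp.single_eq_same] at this ⊢
    omega
  obtain ⟨U, hUfin, hUrank, hUS, hUE⟩ := ih hsupp
  obtain ⟨r, hr, hrker⟩ := hv.exists_residue P
  -- Passing from `E` to `E + P` requires `d P` more dimensions. They come from a linear lift of the
  -- residue space at `P`, multiplied by a function that gives it exact order `E P` at `P` and order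
  -- at least `E` on the rest of `S`.
  obtain ⟨s, hs⟩ := r.exists_rightInverse_of_surjective (LinearMap.range_eq_top.mpr hr)
  have hs' : ∀ b, r (s b) = b := fun b => LinearMap.congr_fun hs b
  let s' : (Fin (d P) → k) →ₗ[k] K := (v.above {P} 0).subtype ∘ₗ s
  obtain ⟨D, hD, hsD⟩ := v.exists_le_space (LinearMap.range s')
    (Module.Finite.iff_fg.mp inferInstance)
  obtain ⟨p, hp, hpP⟩ := hv.exists_ord_eq P (E P)
  -- `D` bounds the poles of the lifts, so vanishing of `e` to order `M` at `Q` compensates both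
  -- these poles and those of `p`.
  obtain ⟨M, hM⟩ : ∃ M : ℕ, ∀ Q ∈ S, D Q + E Q - v.ord Q p ≤ M := by
    refine ⟨S.sup fun Q => (D Q + E Q - v.ord Q p).toNat, fun Q hQ => ?_⟩
    exact (Int.self_le_toNat _).trans
      (by exact_mod_cast Finset.le_sup (f := fun Q => (D Q + E Q - v.ord Q p).toNat) hQ)
  obtain ⟨e, he, heP, heS⟩ := hv.exists_approx P (S.erase P) (Finset.notMem_erase P S) M
  have hep := mul_ne_zero he hp
  let j : (Fin (d P) → k) →ₗ[k] K := LinearMap.mulLeft k (e * p) ∘ₗ s'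
  have hj : ∀ b, j b = e * p * s b := fun b => rfl
  have hjE : LinearMap.range j ≤ v.above S E := by
    rintro _ ⟨b, rfl⟩ h0 Q hQ
    rw [hj] at h0 ⊢
    have hsb := right_ne_zero_of_mul h0
    rw [v.ord_mul Q hep hsb, v.ord_mul Q he hp]
    by_cases hQP : Q = P
    · subst hQP
      have := mem_above_single.mp (s b).2 hsb
      simp only [Pi.zero_apply] at this
      omega
    · have h1 := heS Q (Finset.mem_erase.mpr ⟨hQP, hQ⟩)
      have h2 := hM Q hQ
      have h3 := mem_space.mp (hsD ⟨b, rfl⟩) hsb Q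
      change -D Q ≤ v.ord Q (s b) at h3
      omega
  have hjP : ∀ b, j b ∈ v.above S (E + Finsupp.single P 1 : ι →₀ ℤ) → b = 0 := by
    intro b hb
    rw [← hs' b, hrker, mem_above_single]
    intro hsb
    have := hb (mul_ne_zero hep hsb) P hPS
    rw [hj, v.ord_mul P hep hsb, v.ord_mul P he hp, heP, hpP] at this
    simp only [Finsupp.coe_add, Pi.add_apply, Finsupp.single_eq_same] at this
    simp only [Pi.one_apply]
    omega
  have hjinj : Function.Injective j := by
    rw [injective_iff_map_eq_zero]
    intro b hb
    exact hjP b (hb ▸ Submodule.zero_mem _)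
  have hdisj : U ⊓ LinearMap.range j = ⊥ :=
    le_bot_iff.mp ((inf_le_inf_left U hjE).trans hUE.le)
  refine ⟨U ⊔ LinearMap.range j, Submodule.finite_sup U _, ?_, ?_, ?_⟩
  · have h1 := Submodule.finrank_sup_add_finrank_inf_eq U (LinearMap.range j)
    rw [hdisj, finrank_bot, LinearMap.finrank_range_of_inj hjinj,
      Module.finrank_fintype_fun_eq_card, Fintype.card_fin] at h1
    rw [map_add, divDeg_single, ← hUrank, ← add_zero (Module.finrank k _ ), h1]
    push_cast; ring
  · exact sup_le hUS (hjE.trans (above_mono le_rfl fun Q _ => hE Q))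
  · rw [eq_bot_iff]
    rintro x ⟨hx, hxE⟩
    obtain ⟨u, hu, w, ⟨b, rfl⟩, rfl⟩ := Submodule.mem_sup.mp hx
    have h1 : u + j b ∈ v.above S E := above_mono le_rfl (fun Q _ => hEP Q) hxE
    have h2 : u ∈ v.above S E := by
      simpa using Submodule.sub_mem _ h1 (hjE ⟨b, rfl⟩)
    have hu0 : u = 0 := by
      have : u ∈ U ⊓ v.above S E := ⟨hu, h2⟩
      rwa [hUE, Submodule.mem_bot] at this
    subst hu0
    rw [zero_add] at hxE ⊢
    rw [hjP b hxE, map_zero]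
    exact Submodule.zero_mem _

/-- Let `E` and `F` be the zeros and poles of `x`, and let `U` be the space of dimension `deg E`
from `exists_complement`. Multiplication by `x` sends functions regular on the support of `E` to
functions vanishing to order `E`, so `U, xU, …, xⁿ⁻¹U` are independent and span a space of dimension
`n deg E`. It lies in `L(D + nF)`, of dimension at most a constant plus `n deg F`; now let `n` grow.
-/
lemma divDeg_zeros_le {x : K} (hx : x ≠ 0) :
    divDeg d (v.div x hx ⊔ 0) ≤ divDeg d ((-v.div x hx) ⊔ 0) := by
  set E := v.div x hx ⊔ 0 with hEdef
  set F := (-v.div x hx) ⊔ 0 with hFdef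
  have hE : 0 ≤ E := le_sup_right
  have hF : 0 ≤ F := le_sup_right
  obtain ⟨U, hUfin, hUrank, hUS, hUE⟩ := hv.exists_complement E.support E hE le_rfl
  obtain ⟨D, hD, hUD⟩ := v.exists_le_space U (Module.Finite.iff_fg.mp inferInstance)
  have hxE : x ∈ v.above E.support E := by
    intro _ P hP
    have h0 : E P = max (v.ord P x) 0 := rfl
    rw [Finset.mem_coe, Finsupp.mem_support_iff, h0] at hP
    rw [h0]; omega
  have hxF : x ∈ v.space F := by
    rw [mem_space]
    intro _ P
    have h0 : F P = max (-v.ord P x) 0 := rfl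
    rw [h0]; omega
  have key : ∀ n : ℕ, ∃ W : Submodule k K, Module.Finite k W ∧
      (Module.finrank k W : ℤ) = n * divDeg d E ∧ W ≤ v.above E.support 0 ∧
      W ≤ v.space (D + n • F) := by
    intro n
    induction n with
    | zero => exact ⟨⊥, inferInstance, by simp, bot_le, bot_le⟩
    | succ n ih =>
      obtain ⟨W, hWfin, hWrank, hWS, hWD⟩ := ih
      have hxW : W.map (LinearMap.mulLeft k x) ≤ v.above E.support E := by
        rintro _ ⟨w, hw, rfl⟩
        have := mul_mem_above hxE (hWS hw)
        rwa [add_zero] at this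
      have hdisj : U ⊓ W.map (LinearMap.mulLeft k x) = ⊥ :=
        le_bot_iff.mp ((inf_le_inf_left U hxW).trans hUE.le)
      refine ⟨U ⊔ W.map (LinearMap.mulLeft k x), Submodule.finite_sup _ _, ?_, ?_, ?_⟩
      · have h1 := Submodule.finrank_sup_add_finrank_inf_eq U (W.map (LinearMap.mulLeft k x))
        rw [hdisj, finrank_bot, finrank_map_mulLeft hx] at h1
        rw [← add_zero (Module.finrank k _ ), h1]
        push_cast
        rw [hUrank, hWrank]; ring
      · exact sup_le hUS (hxW.trans (above_mono le_rfl fun Q _ => hE Q))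
      · refine sup_le (hUD.trans (space_mono ?_)) ?_
        · exact le_add_of_nonneg_right (nsmul_nonneg hF _)
        · rintro _ ⟨w, hw, rfl⟩
          have := mul_mem_space hxF (hWD hw)
          rw [succ_nsmul, ← add_assoc, add_comm _ F]
          exact this
  by_contra! hlt
  -- If `deg F + 1 ≤ deg E`, the gap in dimensions is at least `n`, so an `n` beyond the constant
  -- term is contradictory.
  obtain ⟨n, hn⟩ : ∃ n : ℕ, (Module.finrank k (v.space 0) : ℤ) + divDeg d D < n :=
    ⟨((Module.finrank k (v.space 0) : ℤ) + divDeg d D).toNat + 1, by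
      have := Int.self_le_toNat ((Module.finrank k (v.space 0) : ℤ) + divDeg d D)
      push_cast; omega⟩
  obtain ⟨W, hWfin, hWrank, -, hWD⟩ := key n
  obtain ⟨h1, h2⟩ := hv.finite_space_of_nonneg (D + n • F) (add_nonneg hD (nsmul_nonneg hF _))
  have h3 : (Module.finrank k W : ℤ) ≤ _ := Nat.cast_le.mpr (Submodule.finrank_mono hWD)
  rw [map_add, map_nsmul, nsmul_eq_mul] at h2
  have h4 : (n : ℤ) * (divDeg d F + 1) ≤ n * divDeg d E :=
    mul_le_mul_of_nonneg_left hlt (by omega)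
  linarith

/-- A principal divisor has degree zero. -/
theorem divDeg_div {x : K} (hx : x ≠ 0) : divDeg d (v.div x hx) = 0 := by
  have key : ∀ {x : K} (hx : x ≠ 0), divDeg d (v.div x hx) ≤ 0 := by
    intro x hx
    have h := hv.divDeg_zeros_le hx
    have : v.div x hx = (v.div x hx ⊔ 0) - ((-v.div x hx) ⊔ 0) := by
      ext P
      have h1 : (v.div x hx ⊔ 0) P = max (v.ord P x) 0 := rfl
      have h2 : ((-v.div x hx) ⊔ 0) P = max (-v.ord P x) 0 := rfl
      rw [Finsupp.sub_apply, h1, h2, div_apply]; omega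
    rw [this, map_sub]
    omega
  refine le_antisymm (key hx) ?_
  have h := key (inv_ne_zero hx)
  have : v.div x⁻¹ (inv_ne_zero hx) = -v.div x hx := by
    ext P; simp [v.ord_inv P hx]
  rw [this, map_neg] at h
  omega

end IsProperFamily

end OrdFamily

/-! ### Counting points and effective divisors -/

namespace OrdFamily

variable {k K ι : Type*} [Field k] [Field K] [Algebra k K] {v : OrdFamily k K ι}

open Polynomial in
lemma aeval_mem_above {S : Set ι} {n : ι → ℤ} (hn : ∀ P ∈ S, n P ≤ 0) {x : K}
    (hx : x ∈ v.above S n) (p : k[X]) {N : ℕ} (hp : p.natDegree ≤ N) :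
    aeval x p ∈ v.above S (N • n) := by
  rw [aeval_eq_sum_range]
  refine Submodule.sum_mem _ fun i hi => Submodule.smul_mem _ _ ?_
  refine above_mono le_rfl (fun P hP => ?_) (pow_mem_above hx i)
  have hi' : i ≤ N := by rw [Finset.mem_range] at hi; omega
  simp only [Pi.smul_apply, nsmul_eq_mul]
  exact mul_le_mul_of_nonpos_right (by exact_mod_cast hi') (hn P hP)

-- If `x` were algebraic, `x⁻¹` would be a polynomial in `x`, hence regular at `P`; but it has a
-- pole there.
open Polynomial in
lemma transcendental_of_ord_pos {P : ι} {x : K} (hx : x ≠ 0) (h : 0 < v.ord P x) :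
    Transcendental k x := by
  intro halg
  have h1 := halg.isIntegral.inv_mem_adjoin
  rw [Algebra.adjoin_singleton_eq_range_aeval] at h1
  obtain ⟨p, hp⟩ := h1
  have h2 : aeval x p ∈ v.above {P} (p.natDegree • 0) :=
    aeval_mem_above (by simp) (mem_above_single.mpr fun _ => h.le) p le_rfl
  rw [smul_zero] at h2
  replace hp : aeval x p = x⁻¹ := hp
  rw [hp] at h2
  have := mem_above_single.mp h2 (inv_ne_zero hx)
  rw [v.ord_inv P hx] at this
  simp only [Pi.zero_apply] at this
  omega

namespace IsProperFamily

variable {d : ι → ℕ} (hv : v.IsProperFamily d)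
include hv

/-- An element with poles bounded by `F` vanishes at no more than `deg F / n` points of degree
`n`. -/
lemma card_zeros_mul_le (F : ι →₀ ℤ) {y : K} (hy : y ≠ 0) (hyF : y ∈ v.space F) {n : ℕ}
    (T : Finset ι) (hT : ∀ P ∈ T, d P = n ∧ 0 ≤ F P ∧ 0 < v.ord P y) :
    (T.card : ℤ) * n ≤ divDeg d F := by
  classical
  -- The divisor `div y + F` is effective, has the degree of `F`, and contains every point of `T`.
  have hD : 0 ≤ v.div y hy + F := fun P => by
    have := mem_space.mp hyF hy P
    simp only [Finsupp.coe_zero, Pi.zero_apply, Finsupp.coe_add, Pi.add_apply, div_apply]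
    omega
  have h1 : divDeg d (v.div y hy + F) = divDeg d F := by rw [map_add, hv.divDeg_div, zero_add]
  have h2 : ∑ P ∈ T, Finsupp.single P (1 : ℤ) ≤ v.div y hy + F := by
    intro P
    rw [Finsupp.finsetSum_apply]
    by_cases hP : P ∈ T
    · rw [Finset.sum_eq_single P (fun Q _ hQ => by simp [hQ.symm]) (fun h => absurd hP h)]
      obtain ⟨-, h3, h4⟩ := hT P hP
      simp only [Finsupp.single_eq_same, Finsupp.coe_add, Pi.add_apply, div_apply]
      omega
    · rw [Finset.sum_eq_zero fun Q hQ => by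
        rw [Finsupp.single_eq_of_ne]; rintro rfl; exact hP hQ]
      exact hD P
  have h3 := divDeg_mono d h2
  rw [map_sum, h1, Finset.sum_congr rfl (fun P hP => by
    rw [divDeg_single, one_mul, (hT P hP).1])] at h3
  simpa using h3

open Polynomial in
/-- The number of points of degree `n` is `O(qⁿ)`. -/
theorem exists_card_le [Finite k] : ∃ B : ℕ, ∀ n : ℕ, {P | d P = n}.Finite ∧
    {P | d P = n}.ncard ≤ B * Nat.card k ^ n := by
  classical
  rcases isEmpty_or_nonempty ι with hι | ⟨⟨P₀⟩⟩
  · exact ⟨0, fun n => ⟨Set.toFinite _, by simp [Set.eq_empty_of_isEmpty]⟩⟩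
  obtain ⟨x, hx, hxP⟩ := hv.exists_ord_eq_one P₀
  have htr := v.transcendental_of_ord_pos hx (hxP.symm ▸ one_pos)
  set F : ι →₀ ℤ := (-v.div x hx) ⊔ 0 with hF
  have hF0 : 0 ≤ F := le_sup_right
  have hxF : x ∈ v.space F := mem_space.mpr fun _ P => by
    have h0 : F P = max (-v.ord P x) 0 := rfl
    omega
  let Z : Finset ι := (v.finite_support hx).toFinset
  -- `Z` accounts for the zeros and poles of `x`. Every other point of degree `n` is a zero of one
  -- of the `qⁿ⁺¹` polynomials in `x` of degree at most `n`, each of which has at most `deg F` zeros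
  -- of degree `n`.
  refine ⟨Z.card + Nat.card k * (divDeg d F).toNat, fun n => ?_⟩
  rcases Nat.eq_zero_or_pos n with rfl | hn
  · have : {P | d P = 0} = ∅ := by
      ext P; simpa using (hv.deg_pos P).ne'
    simp [this]
  let _ : Fintype k := Fintype.ofFinite k
  have e : degreeLT k (n + 1) ≃ (Fin (n + 1) → k) := (degreeLTEquiv k (n + 1)).toEquiv
  let _ : Fintype (degreeLT k (n + 1)) := Fintype.ofEquiv _ e.symm
  have hcard : Fintype.card (degreeLT k (n + 1)) = Nat.card k ^ (n + 1) := by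
    rw [Fintype.card_congr e]; simp
  have hne : ∀ p : k[X], p ≠ 0 → aeval x p ≠ 0 := fun p hp h0 =>
    hp ((transcendental_iff.mp htr) p h0)
  let A : degreeLT k (n + 1) → Finset ι := fun p =>
    if hp : (p : k[X]) = 0 then ∅ else
      (v.finite_support (hne _ hp)).toFinset.filter fun P => d P = n ∧ 0 < v.ord P (aeval x (p : k[X]))
  have hA : ∀ p, (A p).card ≤ (divDeg d F).toNat := by
    intro p
    by_cases hp : (p : k[X]) = 0
    · simp only [A, hp, dif_pos, Finset.card_empty, zero_le]
    have hdeg : (p : k[X]).natDegree ≤ n := by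
      have := mem_degreeLT.mp p.2
      rw [← natDegree_lt_iff_degree_lt hp] at this
      omega
    have hmem : aeval x (p : k[X]) ∈ v.space (n • F) := by
      have := aeval_mem_above (v := v) (S := Set.univ) (n := -⇑F)
        (fun P _ => neg_nonpos.mpr (hF0 P)) hxF p hdeg
      rw [smul_neg] at this
      exact this
    have := hv.card_zeros_mul_le (n • F) (hne _ hp) hmem (n := n) (A p) (by
      intro P hP
      simp only [A, hp, dif_neg, not_false_eq_true, Finset.mem_filter] at hP
      exact ⟨hP.2.1, nsmul_nonneg hF0 n P, hP.2.2⟩)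
    rw [map_nsmul, nsmul_eq_mul, mul_comm] at this
    have := le_of_mul_le_mul_left this (by exact_mod_cast hn)
    omega
  have hsub : {P | d P = n} ⊆ ((Z ∪ Finset.univ.biUnion A : Finset ι) : Set ι) := by
    intro P hP
    replace hP : d P = n := hP
    by_cases hPZ : P ∈ Z
    · exact Finset.mem_coe.mpr (Finset.mem_union_left _ hPZ)
    have hxP0 : v.ord P x = 0 := by simpa [Z] using hPZ
    obtain ⟨r, -, hr⟩ := hv.exists_residue P
    have hmem : ∀ p : k[X], aeval x p ∈ v.above {P} 0 := fun p => by
      have := aeval_mem_above (v := v) (S := {P}) (n := 0) (by simp)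
        (mem_above_single.mpr fun _ => hxP0.ge) p le_rfl
      rwa [smul_zero] at this
    let g : degreeLT k (n + 1) →ₗ[k] (Fin (d P) → k) :=
      r ∘ₗ ((aeval x).toLinearMap.codRestrict (v.above {P} 0) hmem) ∘ₗ (degreeLT k (n + 1)).subtype
    -- The polynomials of degree at most `n` form a space of dimension `n + 1`, and the residue
    -- space at `P` has dimension `n`; so some nonzero `p(x)` vanishes at `P`.
    have hg : ¬ Function.Injective g := by
      intro hinj
      have : Module.Finite k (degreeLT k (n + 1)) := Module.Finite.equiv (degreeLTEquiv k _).symm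
      have := LinearMap.finrank_le_finrank_of_injective hinj
      rw [(degreeLTEquiv k (n + 1)).finrank_eq] at this
      simp [hP] at this
    rw [injective_iff_map_eq_zero] at hg
    push Not at hg
    obtain ⟨p, hp0, hp⟩ := hg
    have hp' : (p : k[X]) ≠ 0 := fun h => hp (Subtype.ext h)
    have h1 := mem_above_single.mp ((hr _).mp hp0) (hne _ hp')
    simp only [Pi.one_apply] at h1
    replace h1 : 1 ≤ v.ord P (aeval x (p : k[X])) := h1
    refine Finset.mem_coe.mpr (Finset.mem_union_right _ (Finset.mem_biUnion.mpr
      ⟨p, Finset.mem_univ _, ?_⟩))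
    simp only [A, hp', dif_neg, not_false_eq_true, Finset.mem_filter, Set.Finite.mem_toFinset,
      Set.mem_ofPred_eq]
    omega
  refine ⟨(Finset.finite_toSet _).subset hsub, ?_⟩
  have h1 := Set.ncard_le_ncard hsub (Finset.finite_toSet _)
  rw [Set.ncard_coe_finset] at h1
  have h2 := Finset.card_union_le Z (Finset.univ.biUnion A)
  have h3 := Finset.card_biUnion_le_card_mul Finset.univ A _ (fun p _ => hA p)
  rw [Finset.card_univ, hcard] at h3
  have h4 : Z.card ≤ Z.card * Nat.card k ^ n := Nat.le_mul_of_pos_right _ (pow_pos Nat.card_pos _)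
  calc _ ≤ Z.card * Nat.card k ^ n + Nat.card k ^ (n + 1) * (divDeg d F).toNat := by omega
    _ = _ := by ring

omit hv in
/-- The nonzero elements without zeros and poles. -/
def _root_.CurveZeta.OrdFamily.units (v : OrdFamily k K ι) : Set K :=
  {x | x ≠ 0 ∧ ∀ P, v.ord P x = 0}

omit hv in
/-- The effective divisors that are linearly equivalent to `D`. -/
def _root_.CurveZeta.OrdFamily.linearSystem (v : OrdFamily k K ι) (D : ι →₀ ℤ) : Set (ι →₀ ℕ) :=
  {E | ∃ x : K, x ≠ 0 ∧ ∀ P, (E P : ℤ) = D P + v.ord P x}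

lemma finite_coe_space [Finite k] (D : ι →₀ ℤ) : Finite (v.space D) := by
  have := hv.finite_space D
  exact Module.finite_of_finite k

lemma finite_units [Finite k] : Finite v.units := by
  have := hv.finite_coe_space 0
  exact Finite.of_injective (fun x : v.units => (⟨x, mem_space.mpr fun _ P => by
    simp [x.2.2 P]⟩ : v.space 0)) fun x y h => Subtype.ext (congrArg (fun z : v.space 0 => (z : K)) h)

lemma card_units_pos [Finite k] : 0 < Nat.card v.units := by
  have := hv.finite_units
  have : Nonempty v.units := ⟨1, one_ne_zero, fun P => v.ord_one P⟩
  exact Nat.card_pos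

/-- A linear system has `(#L(D) - 1) / #units` elements, and it is finite. -/
theorem card_linearSystem_mul [Finite k] (D : ι →₀ ℤ) : Finite (v.linearSystem D) ∧
    Nat.card (v.linearSystem D) * Nat.card v.units = Nat.card (v.space D) - 1 := by
  classical
  -- With one function `x E` fixed for each `E`, a nonzero `y ∈ L(D)` corresponds to the pair of `E
  -- = D + div y` and the unit `y / x E`.
  choose x hx hxE using fun E : v.linearSystem D => E.2
  let φ : v.linearSystem D × v.units → {y : v.space D // y ≠ 0} := fun Eh =>
    ⟨⟨x Eh.1 * Eh.2, mem_space.mpr fun _ P => by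
      rw [v.ord_mul P (hx _) Eh.2.2.1, Eh.2.2.2 P]
      have := hxE Eh.1 P
      omega⟩, fun h => mul_ne_zero (hx Eh.1) Eh.2.2.1 (congrArg Subtype.val h)⟩
  have hφ : Function.Bijective φ := by
    constructor
    · rintro ⟨E, h⟩ ⟨E', h'⟩ heq
      have heq : x E * (h : K) = x E' * h' := congrArg (fun y => ((y.1 : v.space D) : K)) heq
      have hE : E = E' := by
        ext P
        have h1 := v.ord_mul P (hx E) h.2.1
        have h2 := v.ord_mul P (hx E') h'.2.1
        rw [h.2.2 P] at h1
        rw [h'.2.2 P, ← heq] at h2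
        have h3 := hxE E P
        have h4 := hxE E' P
        omega
      subst hE
      exact Prod.ext rfl (Subtype.ext (mul_left_cancel₀ (hx E) heq))
    · rintro ⟨⟨y, hy⟩, hy0⟩
      have hy0' : y ≠ 0 := fun h => hy0 (Subtype.ext h)
      have hyD := mem_space.mp hy hy0'
      let E : ι →₀ ℕ := (D + v.div y hy0').mapRange Int.toNat rfl
      have hE : ∀ P, (E P : ℤ) = D P + v.ord P y := fun P => by
        have := hyD P
        simp only [E, Finsupp.mapRange_apply, Finsupp.coe_add, Pi.add_apply, div_apply]
        omega
      let E' : v.linearSystem D := ⟨E, y, hy0', hE⟩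
      refine ⟨(E', ⟨(x E')⁻¹ * y, mul_ne_zero (inv_ne_zero (hx _)) hy0', fun P => ?_⟩), ?_⟩
      · rw [v.ord_mul P (inv_ne_zero (hx _)) hy0', v.ord_inv P (hx _)]
        have h1 := hxE E' P
        have h2 := hE P
        change (E P : ℤ) = _ at h1
        omega
      · refine Subtype.ext (Subtype.ext ?_)
        exact mul_inv_cancel_left₀ (hx E') y
  have hfin := hv.finite_coe_space D
  have hne : Nonempty v.units := ⟨1, one_ne_zero, fun P => v.ord_one P⟩
  have hfp : Finite (v.linearSystem D × v.units) := Finite.of_injective φ hφ.1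
  refine ⟨Finite.of_injective (fun E => (E, Classical.arbitrary v.units)) fun E E' h =>
    (Prod.ext_iff.mp h).1, ?_⟩
  rw [← Nat.card_prod, Nat.card_congr (Equiv.ofBijective φ hφ)]
  let _ := Fintype.ofFinite (v.space D)
  rw [Nat.card_eq_fintype_card, Nat.card_eq_fintype_card]
  exact Set.card_ne_eq (0 : v.space D)

end IsProperFamily

end OrdFamily

/-! ### Summation -/

/-- Grouped by degree, the points of degree `n` contribute at most `B (q r)ⁿ`, the term of a
convergent geometric series. -/
lemma summable_pow_of_ncard_le {ι : Type*} (d : ι → ℕ) (B q : ℕ)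
    (h : ∀ n : ℕ, {P | d P = n}.Finite ∧ {P | d P = n}.ncard ≤ B * q ^ n) {r : ℝ} (hr : 0 ≤ r)
    (hqr : q * r < 1) : Summable fun P => r ^ d P := by
  rw [← (Equiv.sigmaFiberEquiv d).summable_iff]
  have hfin : ∀ n, Finite {P // d P = n} := fun n => (h n).1
  rw [summable_sigma_of_nonneg (fun _ => by exact pow_nonneg hr _)]
  refine ⟨fun n => Summable.of_finite, ?_⟩
  refine Summable.of_nonneg_of_le (fun n => tsum_nonneg fun _ => pow_nonneg hr _) (fun n => ?_)
    ((summable_geometric_of_lt_one (by positivity) hqr).mul_left (B : ℝ))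
  let _ := Fintype.ofFinite {P // d P = n}
  rw [tsum_fintype, Finset.sum_congr rfl (g := fun _ => r ^ n) (fun P _ => by
    simp [Equiv.sigmaFiberEquiv, P.2])]
  rw [Finset.sum_const, nsmul_eq_mul, mul_pow, ← mul_assoc]
  refine mul_le_mul_of_nonneg_right ?_ (pow_nonneg hr n)
  have := (h n).2
  rw [← Nat.card_coe_set_eq] at this
  rw [Finset.card_univ, ← Nat.card_eq_fintype_card]
  exact_mod_cast this

/-- For `x ≤ 1 / 2` one has `1 / (1 - x) ≤ 1 + 2x ≤ exp (2x)`. -/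
lemma sum_range_pow_le_exp {x : ℝ} (h0 : 0 ≤ x) (h1 : x ≤ 1 / 2) (N : ℕ) :
    ∑ n ∈ Finset.range N, x ^ n ≤ Real.exp (2 * x) := by
  have hx : x < 1 := by linarith
  refine ((summable_geometric_of_lt_one h0 hx).sum_le_tsum _ fun n _ => pow_nonneg h0 n).trans ?_
  rw [tsum_geometric_of_lt_one h0 hx]
  refine le_trans ?_ (Real.add_one_le_exp (2 * x))
  rw [inv_le_iff_one_le_mul₀ (by linarith)]
  nlinarith

/-- An Euler product bound: finitely many divisors lie in a box with finite support and bounded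
multiplicities. The sum over the box factors into truncated geometric series, bounded by `exp (2 ∑ x
P)` uniformly in the box. -/
lemma summable_finsupp_prod_pow {ι : Type*} (x : ι → ℝ) (h0 : ∀ P, 0 ≤ x P)
    (h1 : ∀ P, x P ≤ 1 / 2) (hx : Summable x) :
    Summable fun D : ι →₀ ℕ => D.prod fun P n => x P ^ n := by
  classical
  refine summable_of_sum_le (c := Real.exp (2 * ∑' P, x P))
    (fun D => Finset.prod_nonneg fun P _ => pow_nonneg (h0 P) _) fun s => ?_
  let S : Finset ι := s.biUnion Finsupp.support
  have hS : ∀ D ∈ s, D.support ⊆ S := fun D hD => Finset.subset_biUnion_of_mem Finsupp.support hD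
  obtain ⟨N, hN⟩ : ∃ N : ℕ, ∀ D ∈ s, ∀ P ∈ S, D P < N := by
    refine ⟨s.sup (fun D => S.sup D) + 1, fun D hD P hP => Nat.lt_succ_of_le ?_⟩
    exact (Finset.le_sup (f := D) hP).trans (Finset.le_sup (f := fun D : ι →₀ ℕ => S.sup D) hD)
  let res : (ι →₀ ℕ) → (S → ℕ) := fun D P => D P
  have hinj : Set.InjOn res s := by
    intro D hD E hE h
    ext P
    by_cases hP : P ∈ S
    · exact congrFun h ⟨P, hP⟩
    · rw [Finsupp.notMem_support_iff.mp fun h => hP (hS D hD h),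
        Finsupp.notMem_support_iff.mp fun h => hP (hS E hE h)]
  calc ∑ D ∈ s, D.prod (fun P n => x P ^ n) = ∑ D ∈ s, ∏ P : S, x P ^ (res D P) := by
        refine Finset.sum_congr rfl fun D hD => ?_
        rw [Finsupp.prod_of_support_subset D (hS D hD) _ (by simp), ← Finset.prod_coe_sort]
    _ = ∑ g ∈ s.image res, ∏ P : S, x P ^ g P :=
        (Finset.sum_image (f := fun g : S → ℕ => ∏ P : S, x P ^ g P) hinj).symm
    _ ≤ ∑ g ∈ Fintype.piFinset fun _ : S => Finset.range N, ∏ P : S, x P ^ g P := by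
        refine Finset.sum_le_sum_of_subset_of_nonneg ?_
          fun g _ _ => Finset.prod_nonneg fun P _ => pow_nonneg (h0 P) _
        intro g hg
        obtain ⟨D, hD, rfl⟩ := Finset.mem_image.mp hg
        rw [Fintype.mem_piFinset]
        exact fun P => Finset.mem_range.mpr (hN D hD P P.2)
    _ = ∏ P : S, ∑ n ∈ Finset.range N, x P ^ n := (Finset.prod_univ_sum _ _).symm
    _ ≤ ∏ P : S, Real.exp (2 * x P) := Finset.prod_le_prod
        (fun P _ => Finset.sum_nonneg fun n _ => pow_nonneg (h0 P) n)
        fun P _ => sum_range_pow_le_exp (h0 P) (h1 P) N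
    _ = Real.exp (2 * ∑ P ∈ S, x P) := by
        rw [← Real.exp_sum, Finset.mul_sum, ← Finset.sum_coe_sort S]
    _ ≤ Real.exp (2 * ∑' P, x P) := by
        gcongr
        exact hx.sum_le_tsum _ fun P _ => h0 P

/-- The series over effective divisors converges. -/
lemma summable_pow_degree {ι : Type*} (d : ι → ℕ) (B q : ℕ) (hd : ∀ P, 0 < d P) (hq : 2 ≤ q)
    (h : ∀ n : ℕ, {P | d P = n}.Finite ∧ {P | d P = n}.ncard ≤ B * q ^ n) {r : ℝ} (hr : 0 ≤ r)
    (hqr : q * r < 1) : Summable fun D : ι →₀ ℕ => r ^ (D.sum fun P n => n * d P) := by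
  have h2 : (2 : ℝ) ≤ q := by exact_mod_cast hq
  -- Here `q ≥ 2` enters, through `q r < 1`.
  have hr2 : r ≤ 1 / 2 := by nlinarith
  have := summable_finsupp_prod_pow (fun P => r ^ d P) (fun P => pow_nonneg hr _)
    (fun P => (pow_le_of_le_one hr (by linarith) (hd P).ne').trans hr2)
    (summable_pow_of_ncard_le d B q h hr hqr)
  refine this.congr fun D => ?_
  rw [Finsupp.sum, Finsupp.prod, ← Finset.prod_pow_eq_pow_sum]
  exact Finset.prod_congr rfl fun P _ => by rw [← pow_mul, mul_comm]

/-! ### Orders in a discrete valuation ring -/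

section DVR

variable {R : Type*} [CommRing R] [IsDomain R] [IsDiscreteValuationRing R] [Ring.KrullDimLE 1 R]
  {K : Type*} [Field K] [Algebra R K] [IsFractionRing R K]

-- `Ring.ordFrac` is the inverse of the multiplicative adic valuation, and the elements of valuation
-- at most `1` are those of `R`.
open IsDedekindDomain in
lemma one_le_ordFrac_iff {x : K} (hx : x ≠ 0) :
    1 ≤ Ring.ordFrac R x ↔ ∃ a : R, algebraMap R K a = x := by
  have hv : (IsDiscreteValuationRing.maximalIdeal R).valuation K x ≠ 0 := by simpa using hx
  rw [Ring.ordFrac_eq_valuation_inv, one_le_inv₀ (zero_lt_iff.mpr hv)]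
  refine ⟨IsDiscreteValuationRing.exists_lift_of_le_one, ?_⟩
  rintro ⟨a, rfl⟩
  exact HeightOneSpectrum.valuation_le_one _ a

open IsDedekindDomain in
lemma exp_one_le_ordFrac_iff {a : R} (ha : a ≠ 0) :
    WithZero.exp 1 ≤ Ring.ordFrac R (algebraMap R K a) ↔ a ∈ IsLocalRing.maximalIdeal R := by
  have hv : (IsDiscreteValuationRing.maximalIdeal R).valuation K (algebraMap R K a) ≠ 0 := by
    simpa using ha
  rw [Ring.ordFrac_eq_valuation_inv]
  have h1 := HeightOneSpectrum.valuation_lt_one_iff_mem (K := K)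
    (IsDiscreteValuationRing.maximalIdeal R) a
  rw [show IsLocalRing.maximalIdeal R = (IsDiscreteValuationRing.maximalIdeal R).asIdeal from rfl,
    ← h1]
  generalize (IsDiscreteValuationRing.maximalIdeal R).valuation K (algebraMap R K a) = w at hv
  rw [← WithZero.exp_log hv, ← WithZero.exp_neg, WithZero.exp_le_exp, ← WithZero.exp_zero,
    WithZero.exp_lt_exp]
  omega

end DVR

/-! ### Regular curves -/

section RegularCurve

/-- A regular noetherian integral scheme of dimension one. -/
class IsRegularCurve (X : Scheme.{u}) [IsIntegral X] [IsNoetherian X] : Prop where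
  isRegularLocalRing_stalk : ∀ x : X, IsRegularLocalRing (X.presheaf.stalk x)
  topologicalKrullDim_eq_one : topologicalKrullDim X = 1

variable {X : Scheme.{u}} [IsIntegral X] [IsNoetherian X] [hX : IsRegularCurve X]

lemma krullDim_eq_one (X : Scheme.{u}) [IsIntegral X] [IsNoetherian X] [hX : IsRegularCurve X] :
    Order.krullDim X = 1 := by
  rw [← hX.topologicalKrullDim_eq_one, topologicalKrullDim]
  exact (Order.krullDim_eq_of_orderIso irreducibleSetEquivPoints).symm

lemma coheight_le_one (x : X) : Order.coheight x ≤ 1 := by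
  have := Order.coheight_le_krullDim x
  rw [krullDim_eq_one X] at this
  exact_mod_cast this

lemma coheight_eq_one_iff {x : X} : Order.coheight x = 1 ↔ x ≠ genericPoint X := by
  constructor
  · rintro h rfl
    have : Order.coheight (⊤ : X) = 0 := by simp
    rw [show genericPoint X = (⊤ : X) from rfl, this] at h
    exact zero_ne_one h
  · intro h
    refine le_antisymm (coheight_le_one x) ?_
    rw [Order.one_le_iff_ne_zero, ne_eq, Order.coheight_eq_zero]
    intro hmax
    have h1 : x ⤳ genericPoint X := hmax (le_top (a := x))
    exact h (h1.antisymm (genericPoint_specializes x)).eq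

/-- A proper specialization of a non-generic point would have coheight at least two. -/
lemma isClosed_of_ne_genericPoint {x : X} (h : x ≠ genericPoint X) : IsClosed {x} := by
  rw [← closure_subset_iff_isClosed]
  intro y hy
  have hyx : y ≤ x := specializes_iff_mem_closure.mpr hy
  by_contra hne
  have hlt : y < x := lt_of_le_not_ge hyx fun hxy =>
    hne (Specializes.antisymm (x := y) (y := x) hxy hyx).eq
  have h1 := Order.coheight_add_one_le hlt
  rw [coheight_eq_one_iff.mpr h] at h1
  have h2 := h1.trans (coheight_le_one y)
  exact absurd h2 (by decide)

lemma not_isClosed_genericPoint : ¬ IsClosed {genericPoint X} := by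
  intro h
  have h1 : closure {genericPoint X} = Set.univ := genericPoint_closure X
  rw [h.closure_eq] at h1
  have : Subsingleton X := ⟨fun a b => by
    have ha : a ∈ ({genericPoint X} : Set X) := h1 ▸ Set.mem_univ a
    have hb : b ∈ ({genericPoint X} : Set X) := h1 ▸ Set.mem_univ b
    rw [Set.mem_singleton_iff] at ha hb
    rw [ha, hb]⟩
  have h2 := krullDim_eq_one X
  have h3 : Order.krullDim X ≤ 0 := Order.krullDim_nonpos_of_subsingleton
  rw [h2] at h3
  exact absurd h3 (by decide)

lemma isClosed_singleton_iff {x : X} : IsClosed {x} ↔ x ≠ genericPoint X :=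
  ⟨fun h => by rintro rfl; exact not_isClosed_genericPoint h, isClosed_of_ne_genericPoint⟩

omit [AlgebraicGeometry.IsNoetherian X] hX in
lemma mem_of_nonempty {U : X.Opens} (hU : (U : Set X).Nonempty) : genericPoint X ∈ U :=
  ((genericPoint_spec X).mem_open_set_iff U.isOpen).mpr (by simpa using hU)

/-- A nonempty open subset of a curve has finite complement. -/
lemma finite_compl {U : X.Opens} (hU : genericPoint X ∈ U) : ((U : Set X)ᶜ).Finite := by
  obtain ⟨S, hS, hirr, hUS⟩ := TopologicalSpace.NoetherianSpace.exists_finite_set_isClosed_irreducible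
    (s := (U : Set X)ᶜ) U.isOpen.isClosed_compl
  obtain ⟨hirr, hUS⟩ := hUS
  rw [hUS]
  refine hS.sUnion fun Z hZ => ?_
  -- The generic point of a component of the complement is not that of `X`, so it is closed and is
  -- the whole component.
  obtain ⟨z, hz⟩ := QuasiSober.sober (hirr Z hZ) (‹∀ t ∈ S, IsClosed t› Z hZ)
  have hzU : z ∉ U := by
    have : z ∈ (U : Set X)ᶜ := hUS ▸ Set.mem_sUnion_of_mem hz.mem hZ
    exact this
  have hcl := isClosed_of_ne_genericPoint (x := z) (by rintro rfl; exact hzU hU)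
  rw [← hz.def, hcl.closure_eq]
  exact Set.finite_singleton z

/-- The complement of a finite set of closed points. -/
def complOfFinite (S : Set X) (hS : S.Finite) (hη : genericPoint X ∉ S) : X.Opens where
  carrier := Sᶜ
  is_open' := by
    rw [isOpen_compl_iff, ← Set.biUnion_of_singleton S]
    exact hS.isClosed_biUnion fun x hx =>
      isClosed_of_ne_genericPoint (by rintro rfl; exact hη hx)

/-- Regularity in dimension one means that the cotangent space is a line, which characterizes
discrete valuation rings. -/
lemma isDiscreteValuationRing_stalk {x : X} (h : x ≠ genericPoint X) :
    IsDiscreteValuationRing (X.presheaf.stalk x) := by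
  have hreg := hX.isRegularLocalRing_stalk x
  have h1 : ringKrullDim (X.presheaf.stalk x) = 1 := by
    rw [ringKrullDim_stalk_eq_coheight, coheight_eq_one_iff.mpr h]; rfl
  have hf : ¬ IsField (X.presheaf.stalk x) := fun hf => by
    rw [ringKrullDim_eq_zero_of_isField hf] at h1
    exact zero_ne_one h1
  have h2 := (IsRegularLocalRing.iff_finrank_cotangentSpace _).mp hreg
  rw [h1] at h2
  exact ((IsDiscreteValuationRing.TFAE (X.presheaf.stalk x) hf).out 0 5).mpr (by exact_mod_cast h2)

lemma krullDimLE_stalk (x : X) : Ring.KrullDimLE 1 (X.presheaf.stalk x) :=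
  krullDimLE_of_coheight_le (coheight_le_one x)

/-! ### Orders on a regular curve -/

lemma ord_genericPoint (z : X.functionField) : Scheme.ord z (genericPoint X) = 0 :=
  Scheme.ord_eq_zero_of_coheight_neq_one (fun h => coheight_eq_one_iff.mp h rfl) z

lemma ord_nonneg_iff {x : X} {z : X.functionField} (hz : z ≠ 0) :
    0 ≤ Scheme.ord z x ↔ ∃ a : X.presheaf.stalk x, algebraMap _ X.functionField a = z := by
  -- At the generic point the order is `0` by convention and the stalk is the whole function field.
  by_cases hx : x = genericPoint X
  · subst hx
    refine iff_of_true (ord_genericPoint z).ge ⟨z, ?_⟩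
    have : X.presheaf.stalkSpecializes (specializes_refl (genericPoint X)) = 𝟙 _ := by simp
    exact congr($this z)
  have := isDiscreteValuationRing_stalk hx
  have := krullDimLE_stalk x
  rw [Scheme.le_ord_iff (coheight_eq_one_iff.mpr hx) hz]
  exact one_le_ordFrac_iff hz

lemma one_le_ord_iff {x : X} (hx : x ≠ genericPoint X) {a : X.presheaf.stalk x} (ha : a ≠ 0) :
    1 ≤ Scheme.ord (algebraMap _ X.functionField a) x ↔ a ∈ IsLocalRing.maximalIdeal _ := by
  have := isDiscreteValuationRing_stalk hx
  have := krullDimLE_stalk x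
  rw [Scheme.le_ord_iff (coheight_eq_one_iff.mpr hx) (by simpa using ha)]
  exact exp_one_le_ordFrac_iff ha

lemma exists_ord_eq_one {x : X} (hx : x ≠ genericPoint X) :
    ∃ z : X.functionField, z ≠ 0 ∧ Scheme.ord z x = 1 := by
  have := isDiscreteValuationRing_stalk hx
  have := krullDimLE_stalk x
  obtain ⟨ϖ, hϖ⟩ := IsDiscreteValuationRing.exists_irreducible (X.presheaf.stalk x)
  have h0 : algebraMap _ X.functionField ϖ ≠ 0 := by simpa using hϖ.ne_zero
  refine ⟨_, h0, ?_⟩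
  rw [Scheme.ord_eq_iff (coheight_eq_one_iff.mpr hx) h0]
  exact Ring.ordFrac_irreducible hϖ

lemma finite_ord_ne_zero {z : X.functionField} (hz : z ≠ 0) : {x | Scheme.ord z x ≠ 0}.Finite := by
  obtain ⟨U, -, s, hU, rfl, hs⟩ := exists_isUnit_germ_eq X z hz
  refine (finite_compl (mem_of_nonempty (U := U) (Set.nonempty_coe_sort.mp hU))).subset ?_
  intro x hx hxU
  exact hx (Scheme.ord_of_isUnit hs hxU)

end RegularCurve

/-! ### Sections and local rings in terms of orders -/

section RegularCurve

variable {X : Scheme.{u}} [IsIntegral X] [AlgebraicGeometry.IsNoetherian X] [hX : IsRegularCurve X]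

/-- A rational function without poles on `U` is the germ of a section over `U`. -/
lemma exists_germ_eq_of_ord_nonneg {U : X.Opens} (hU : genericPoint X ∈ U) {z : X.functionField}
    (hz : z ≠ 0 → ∀ x ∈ U, 0 ≤ Scheme.ord z x) :
    ∃ s : Γ(X, U), X.presheaf.germ U (genericPoint X) hU s = z := by
  by_cases h0 : z = 0
  · exact ⟨0, by rw [h0, map_zero]⟩
  have hloc : ∀ x : U, ∃ (V : X.Opens) (hVU : V ≤ U) (hxV : x.1 ∈ V) (hV : genericPoint X ∈ V)
      (s : Γ(X, V)), X.presheaf.germ V (genericPoint X) hV s = z := by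
    rintro ⟨x, hx⟩
    obtain ⟨a, ha⟩ := (ord_nonneg_iff h0).mp (hz h0 x hx)
    obtain ⟨V, hVU, hxV, s, hs⟩ := X.presheaf.exists_le_germ_eq a hx
    have hV := mem_of_nonempty (U := V) ⟨x, hxV⟩
    have : Nonempty V := ⟨⟨x, hxV⟩⟩
    refine ⟨V, hVU, hxV, hV, s, ?_⟩
    rw [← ha, ← hs]
    exact (Scheme.algebraMap_germ_eq_germToFunctionField X hxV s).symm
  choose V hVU hxV hV s hs using hloc
  -- The local lifts of `z` agree on overlaps because they have the same generic germ and `X` is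
  -- integral.
  have hcompat : TopCat.Presheaf.IsCompatible X.sheaf.1 V s := by
    intro i j
    have hij : genericPoint X ∈ V i ⊓ V j := ⟨hV i, hV j⟩
    apply germ_injective_of_isIntegral X (genericPoint X) hij
    have h1 := TopCat.Presheaf.germ_res_apply X.presheaf (TopologicalSpace.Opens.infLELeft (V i) (V j))
      (genericPoint X) hij (s i)
    have h2 := TopCat.Presheaf.germ_res_apply X.presheaf (TopologicalSpace.Opens.infLERight (V i) (V j))
      (genericPoint X) hij (s j)
    exact (h1.trans (hs i)).trans (h2.trans (hs j)).symm
  obtain ⟨t, ht, -⟩ := X.sheaf.existsUnique_gluing' V U (fun i => homOfLE (hVU i))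
    (fun x hx => TopologicalSpace.Opens.mem_iSup.mpr ⟨⟨x, hx⟩, hxV _⟩) s hcompat
  refine ⟨t, ?_⟩
  let x : U := ⟨genericPoint X, hU⟩
  rw [← hs x, ← ht x]
  exact (TopCat.Presheaf.germ_res_apply X.presheaf (homOfLE (hVU x)) (genericPoint X) (hV x) t).symm

lemma ord_germ_nonneg {U : X.Opens} (hU : genericPoint X ∈ U) (s : Γ(X, U)) {x : X} (hx : x ∈ U) :
    0 ≤ Scheme.ord (X.presheaf.germ U (genericPoint X) hU s) x := by
  by_cases h0 : X.presheaf.germ U (genericPoint X) hU s = 0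
  · rw [h0, Scheme.ord_zero]; rfl
  have : Nonempty U := ⟨⟨x, hx⟩⟩
  exact (ord_nonneg_iff h0).mpr ⟨_, Scheme.algebraMap_germ_eq_germToFunctionField X hx s⟩

/-- Distinct closed points of a separated curve have incomparable local rings. -/
lemma exists_ord_neg_and_ord_nonneg [X.IsSeparated] {x y : X} (hxη : x ≠ genericPoint X)
    (hxy : x ≠ y) : ∃ z : X.functionField, z ≠ 0 ∧ Scheme.ord z x < 0 ∧ 0 ≤ Scheme.ord z y := by
  -- Otherwise the local ring of `y` lies inside that of `x` within the function field.
  by_contra! H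
  let ax := algebraMap (X.presheaf.stalk x) X.functionField
  let ay := algebraMap (X.presheaf.stalk y) X.functionField
  have hax : Function.Injective ax := IsFractionRing.injective _ _
  have hle : ∀ b : X.presheaf.stalk y, ay b ∈ ax.range := by
    intro b
    by_cases hb : ay b = 0
    · exact ⟨0, by rw [hb, map_zero]⟩
    have h1 : 0 ≤ Scheme.ord (ay b) y := (ord_nonneg_iff hb).mpr ⟨b, rfl⟩
    have h2 : 0 ≤ Scheme.ord (ay b) x := by
      by_contra! h
      exact absurd h1 (not_le.mpr (H _ hb h))
    exact (ord_nonneg_iff hb).mp h2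
  let e : X.presheaf.stalk x ≃+* ax.range :=
    RingEquiv.ofBijective ax.rangeRestrict ⟨fun a b h => hax (congrArg Subtype.val h),
      ax.rangeRestrict_surjective⟩
  obtain ⟨g, hg⟩ : ∃ g : X.presheaf.stalk y ⟶ X.presheaf.stalk x, ∀ b, ax (g b) = ay b :=
    ⟨CommRingCat.ofHom (e.symm.toRingHom.comp (ay.codRestrict ax.range hle)), fun b =>
      congrArg Subtype.val (e.apply_symm_apply (ay.codRestrict ax.range hle b))⟩
  let ι : Spec X.functionField ⟶ Spec (X.presheaf.stalk x) :=
    Spec.map (X.presheaf.stalkSpecializes (genericPoint_specializes x))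
  have hdom : IsDominant ι := by
    constructor
    exact (PrimeSpectrum.denseRange_comap_iff_ker_le_nilRadical _).mpr fun a ha => by
      rw [(injective_iff_map_eq_zero _).mp hax a ha]; exact Submodule.zero_mem _
  have h1 : ι ≫ X.fromSpecStalk x = X.fromSpecStalk (genericPoint X) :=
    Scheme.SpecMap_stalkSpecializes_fromSpecStalk _
  have h2 : ι ≫ Spec.map g ≫ X.fromSpecStalk y =
      X.fromSpecStalk (genericPoint X) := by
    rw [← Scheme.SpecMap_stalkSpecializes_fromSpecStalk (genericPoint_specializes y),
      ← Category.assoc, ← Spec.map_comp]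
    congr 2
    ext b
    exact hg b
  -- Two maps `Spec 𝒪_x ⟶ X` that agree at the generic point are equal, as `X` is separated. So `x`
  -- is in the image of `Spec 𝒪_y`, that is, `x` specializes to `y`, which is impossible for a
  -- closed `x ≠ y`.
  have h3 := ext_of_isDominant ι (h1.trans h2.symm)
  have h4 : x ⤳ y := by
    have : x ∈ Set.range (X.fromSpecStalk y) := by
      have h4 : X.fromSpecStalk x (IsLocalRing.closedPoint _) = x := Scheme.fromSpecStalk_closedPoint
      rw [h3] at h4
      exact ⟨_, h4⟩
    rwa [Scheme.range_fromSpecStalk] at this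
  have h5 := specializes_iff_mem_closure.mp h4
  rw [(isClosed_of_ne_genericPoint hxη).closure_eq] at h5
  exact hxy (Set.mem_singleton_iff.mp h5).symm

end RegularCurve

/-! ### Curves over a field -/

section OverField

variable {k : Type u} [Field k] {X : Scheme.{u}} (f : X ⟶ Spec (.of k))

/-- The structure map from `k` to the global functions. -/
def baseHom : CommRingCat.of k ⟶ Γ(X, ⊤) := (Scheme.ΓSpecIso (.of k)).inv ≫ f.appTop

lemma toSpecΓ_baseHom : X.toSpecΓ ≫ Spec.map (baseHom f) = f := by
  rw [baseHom, Spec.map_comp, ← Category.assoc, ← Scheme.toSpecΓ_naturality, Category.assoc,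
    toSpecΓ_SpecMap_ΓSpecIso_inv, Category.comp_id]

/-- The map from `k` to a residue field. -/
def residueHom (x : X) : CommRingCat.of k ⟶ X.residueField x :=
  baseHom f ≫ X.presheaf.germ ⊤ x trivial ≫ X.residue x

lemma SpecMap_residueHom (x : X) : Spec.map (residueHom f x) = X.fromSpecResidueField x ≫ f := by
  rw [residueHom, Spec.map_comp, Spec.map_comp, Scheme.fromSpecResidueField, Category.assoc]
  conv_rhs => rw [← toSpecΓ_baseHom f]
  rw [← Scheme.fromSpecStalk_toSpecΓ_assoc]
  simp

/-- Zariski's lemma: the inclusion of a closed point is of finite type, and a field of finite type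
over `k` is finite over it. -/
lemma residueHom_finite [LocallyOfFiniteType f] {x : X} (hx : IsClosed {x}) :
    (residueHom f x).hom.Finite := by
  have : IsFinite (X.fromSpecResidueField x ≫ f) := by
    rw [isClosed_singleton_iff_isClosedImmersion] at hx
    rw [isFinite_iff_locallyOfFiniteType_of_jacobsonSpace]
    infer_instance
  rw [← SpecMap_residueHom] at this
  exact (IsFinite.SpecMap_iff _).mp this

/-- `residueDegree` is measured over the residue field of the image point in `Spec k`; this lemma
identifies that field with `k`. -/
lemma surjective_residueHom_id (y : Spec (.of k)) :
    Function.Surjective (residueHom (𝟙 (Spec (.of k))) y).hom := by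
  have hp : y.asIdeal.IsPrime := PrimeSpectrum.isPrime y
  have h : residueHom (𝟙 (Spec (.of k))) y =
      CommRingCat.ofHom (algebraMap (CommRingCat.of k) y.asIdeal.ResidueField) ≫
        (Scheme.Spec.residueFieldIso (.of k) y).inv := by
    rw [Scheme.Spec.algebraMap_residueFieldIso_inv, residueHom, baseHom]
    simp
  rw [h]
  have hm : y.asIdeal.IsMaximal := by
    have : IsField (CommRingCat.of k) := Field.toIsField k
    have h0 : y.asIdeal = ⊥ := by
      let _ : Field (CommRingCat.of k) := inferInstanceAs (Field k)
      exact Ideal.eq_bot_of_prime y.asIdeal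
    rw [h0]
    exact Ideal.bot_isMaximal (K := k)
  rw [CommRingCat.hom_comp, RingHom.coe_comp]
  exact (ConcreteCategory.bijective_of_isIso (Scheme.Spec.residueFieldIso (.of k) y).inv).2.comp
    (Ideal.algebraMap_residueField_surjective y.asIdeal)

lemma residueHom_eq_comp (x : X) :
    residueHom f x = residueHom (𝟙 (Spec (.of k))) (f x) ≫ f.residueFieldMap x := by
  apply Spec.map_injective
  rw [Spec.map_comp, SpecMap_residueHom, SpecMap_residueHom, Category.comp_id,
    Scheme.Hom.SpecMap_residueFieldMap_fromSpecResidueField]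

lemma finrank_residueHom (x : X) :
    letI := (residueHom f x).hom.toAlgebra
    Module.finrank k (X.residueField x) = f.residueDegree x := by
  let _ := (residueHom f x).hom.toAlgebra
  let _ := (f.residueFieldMap x).hom.toAlgebra
  let e : k ≃+* (Spec (.of k)).residueField (f x) :=
    RingEquiv.ofBijective (residueHom (𝟙 (Spec (.of k))) (f x)).hom
      ⟨RingHom.injective _, surjective_residueHom_id (f x)⟩
  refine Algebra.finrank_eq_of_equiv_equiv e (RingEquiv.refl _) ?_
  ext c
  exact congr($(residueHom_eq_comp f x) c).symm

end OverField

/-! ### The family of valuations of a curve -/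

section OverField

variable {k : Type u} [Field k] {X : Scheme.{u}} [IsIntegral X]

/-- The function field of `X`, as an extension of `k`. -/
def FunctionField (_ : X ⟶ Spec (.of k)) : Type u := X.functionField

instance (f : X ⟶ Spec (.of k)) : Field (FunctionField f) := inferInstanceAs (Field X.functionField)

instance (f : X ⟶ Spec (.of k)) : Algebra k (FunctionField f) :=
  (baseHom f ≫ X.presheaf.germ ⊤ (genericPoint X) trivial).hom.toAlgebra

lemma algebraMap_stalk_germ_top (f : X ⟶ Spec (.of k)) (x : X) (c : k) :
    algebraMap (X.presheaf.stalk x) X.functionField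
      (X.presheaf.germ ⊤ x trivial ((baseHom f).hom c)) = algebraMap k (FunctionField f) c :=
  have : Nonempty (⊤ : X.Opens) := ⟨⟨x, trivial⟩⟩
  Scheme.algebraMap_germ_eq_germToFunctionField X _ _

variable [AlgebraicGeometry.IsNoetherian X] [hX : IsRegularCurve X]

/-- The valuations of the function field given by the closed points. -/
def curveOrd (f : X ⟶ Spec (.of k)) :
    OrdFamily k (FunctionField f) {x : X // IsClosed ({x} : Set X)} where
  ord P z := Scheme.ord (X := X) z P.1
  ord_mul P _ _ hx hy := Scheme.ord_mul (X := X) hx hy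
  ord_add P x y _ _ hxy := by
    have := isDiscreteValuationRing_stalk (isClosed_singleton_iff.mp P.2)
    exact Scheme.ord_add (X := X) hxy
  ord_algebraMap P c hc := by
    have : Nonempty (⊤ : X.Opens) := ⟨⟨P.1, trivial⟩⟩
    exact Scheme.ord_of_isUnit (U := (⊤ : X.Opens)) ((IsUnit.mk0 c hc).map (baseHom f).hom) trivial
  finite_support hx := (finite_ord_ne_zero hx).preimage Subtype.val_injective.injOn

/-- The functions of nonnegative order at `P` are the stalk, and those of positive order its maximal
ideal. The required map is reduction to the residue field followed by coordinates in a `k`-basis. -/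
lemma exists_residue_curveOrd (f : X ⟶ Spec (.of k)) [LocallyOfFiniteType f]
    (P : {x : X // IsClosed ({x} : Set X)}) :
    0 < f.residueDegree P.1 ∧
    ∃ r : (curveOrd f).above {P} 0 →ₗ[k] (Fin (f.residueDegree P.1) → k),
      Function.Surjective r ∧
        ∀ x, r x = 0 ↔ (x : FunctionField f) ∈ (curveOrd f).above {P} 1 := by
  obtain ⟨x, hx⟩ := P
  have hxη := isClosed_singleton_iff.mp hx
  let O := X.presheaf.stalk x
  let κ := X.residueField x
  let _ : Algebra k O := (baseHom f ≫ X.presheaf.germ ⊤ x trivial).hom.toAlgebra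
  let _ : Algebra k κ := (residueHom f x).hom.toAlgebra
  have hfin : Module.Finite k κ := residueHom_finite f hx
  have hrank : Module.finrank k κ = f.residueDegree x := finrank_residueHom f x
  have hinj : Function.Injective (algebraMap O X.functionField) := IsFractionRing.injective _ _
  let j : O →ₗ[k] FunctionField f :=
    { toFun := fun a => algebraMap O X.functionField a
      map_add' := map_add _
      map_smul' := fun c a => by
        refine (congrArg (algebraMap O X.functionField) (Algebra.smul_def c a)).trans ?_
        refine (map_mul (algebraMap O X.functionField) _ _).trans ?_
        refine Eq.trans ?_ (Algebra.smul_def (A := FunctionField f) c _).symm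
        exact congrArg (· * _) (algebraMap_stalk_germ_top f x c) }
  have hj : ∀ a, j a ∈ (curveOrd f).above {⟨x, hx⟩} 0 := fun a => by
    rw [OrdFamily.mem_above_single]
    exact fun h0 => (ord_nonneg_iff h0).mpr ⟨a, rfl⟩
  let e : O ≃ₗ[k] (curveOrd f).above {⟨x, hx⟩} 0 :=
    LinearEquiv.ofBijective (j.codRestrict _ hj) ⟨fun a b h => hinj (congrArg Subtype.val h), by
      rintro ⟨z, hz⟩
      rw [OrdFamily.mem_above_single] at hz
      by_cases h0 : z = 0
      · exact ⟨0, Subtype.ext (by simp [h0])⟩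
      · obtain ⟨a, ha⟩ := (ord_nonneg_iff (X := X) h0).mp (hz h0)
        exact ⟨a, Subtype.ext ha⟩⟩
  let res : O →ₗ[k] κ :=
    { toFun := fun a => X.residue x a
      map_add' := map_add (X.residue x).hom
      map_smul' := fun c a => by
        rw [Algebra.smul_def, Algebra.smul_def]
        exact map_mul (X.residue x).hom _ _ }
  let b : κ ≃ₗ[k] (Fin (f.residueDegree x) → k) := (Module.finBasisOfFinrankEq k κ hrank).equivFun
  have hker : ∀ a : O, X.residue x a = 0 ↔ a ∈ IsLocalRing.maximalIdeal O := fun a =>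
    IsLocalRing.residue_eq_zero_iff a
  refine ⟨hrank ▸ Module.finrank_pos, b.toLinearMap ∘ₗ res ∘ₗ e.symm.toLinearMap, ?_, ?_⟩
  · refine b.surjective.comp (Function.Surjective.comp (g := res) ?_ e.symm.surjective)
    exact X.residue_surjective x
  · intro z
    obtain ⟨a, rfl⟩ := e.surjective z
    have h1 : (b.toLinearMap ∘ₗ res ∘ₗ e.symm.toLinearMap) (e a) = b (X.residue x a) := by
      simp [res]
    rw [h1, LinearEquiv.map_eq_zero_iff, hker, OrdFamily.mem_above_single]
    by_cases ha : a = 0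
    · subst ha
      exact iff_of_true (Ideal.zero_mem _) (fun h => absurd (by simp) h)
    · have hne : algebraMap O X.functionField a ≠ 0 := by simpa using ha
      exact (one_le_ord_iff hxη ha).symm.trans ⟨fun h _ => h, fun h => h hne⟩

/-- Functions without poles on `X` are global sections. -/
lemma finite_above_curveOrd (f : X ⟶ Spec (.of k)) [IsProper f] :
    Module.Finite k ((curveOrd f).above Set.univ 0) := by
  let _ : Algebra k Γ(X, ⊤) := (baseHom f).hom.toAlgebra
  have hfin : Module.Finite k Γ(X, ⊤) := by
    have h := finite_appTop_of_universallyClosed k f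
    have h2 : (baseHom f).hom.Finite := by
      rw [baseHom, CommRingCat.hom_comp]
      exact h.comp (RingHom.Finite.of_surjective _
        (ConcreteCategory.bijective_of_isIso (Scheme.ΓSpecIso (.of k)).inv).2)
    exact h2
  let j : Γ(X, ⊤) →ₗ[k] FunctionField f :=
    { toFun := fun a => X.presheaf.germ ⊤ (genericPoint X) trivial a
      map_add' := map_add (X.presheaf.germ ⊤ (genericPoint X) trivial).hom
      map_smul' := fun c a => by
        refine (congrArg (X.presheaf.germ ⊤ (genericPoint X) trivial).hom
          (Algebra.smul_def c a)).trans ?_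
        exact (map_mul (X.presheaf.germ ⊤ (genericPoint X) trivial).hom _ _).trans
          (Algebra.smul_def (A := FunctionField f) c _).symm }
  have hle : (curveOrd f).above Set.univ 0 ≤ LinearMap.range j := by
    intro z hz
    obtain ⟨s, hs⟩ := exists_germ_eq_of_ord_nonneg (X := X) (U := ⊤) trivial (z := z) (by
      intro h0 x _
      by_cases hx : x = genericPoint X
      · exact hx ▸ (ord_genericPoint (X := X) z).ge
      · exact hz h0 ⟨x, isClosed_of_ne_genericPoint hx⟩ (Set.mem_univ _))
    exact ⟨s, hs⟩
  exact Module.Finite.of_injective (Submodule.inclusion hle) (Submodule.inclusion_injective hle)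

theorem isProperFamily_curveOrd (f : X ⟶ Spec (.of k)) [IsProper f] :
    (curveOrd f).IsProperFamily fun P => f.residueDegree P.1 where
  deg_pos P := (exists_residue_curveOrd f P).1
  exists_ord_eq_one P := exists_ord_eq_one (isClosed_singleton_iff.mp P.2)
  exists_residue P := (exists_residue_curveOrd f P).2
  exists_separating P Q hPQ := by
    have : X.IsSeparated := by
      rw [Scheme.isSeparated_iff, ← Limits.terminal.comp_from f]
      infer_instance
    exact exists_ord_neg_and_ord_nonneg (isClosed_singleton_iff.mp P.2)
      (fun h => hPQ (Subtype.ext h))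
  finite := finite_above_curveOrd f

end OverField

/-! ### Restriction maps -/

section Restriction

variable {X : Scheme.{u}} {U V W : X.Opens}

/-- Restriction of sections of a module. -/
def res (M : X.Modules) (h : W ≤ U) : Γ(M, U) →+ Γ(M, W) := (M.presheaf.map (homOfLE h).op).hom

/-- Restriction of functions. -/
def resO (h : W ≤ U) : Γ(X, U) →+* Γ(X, W) := (X.presheaf.map (homOfLE h).op).hom

variable (M : X.Modules)

lemma res_res (h : W ≤ V) (h' : V ≤ U) (s : Γ(M, U)) :
    res M h (res M h' s) = res M (h.trans h') s := by
  change (M.presheaf.map _ ≫ M.presheaf.map _) s = _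
  rw [← M.presheaf.map_comp]
  rfl

lemma res_smul (h : W ≤ U) (a : Γ(X, U)) (s : Γ(M, U)) :
    res M h (a • s) = resO h a • res M h s := M.map_smul _ _ _

lemma res_app {M N : X.Modules} (φ : M ⟶ N) (h : W ≤ U) (s : Γ(M, U)) :
    res N h (φ.app U s) = φ.app W (res M h s) :=
  (ConcreteCategory.congr_hom (φ.mapPresheaf.naturality (homOfLE h).op) s).symm

lemma exists_res_eq_of_cover {ι : Type u} {V : X.Opens} (U : ι → X.Opens) (hU : ∀ i, U i ≤ V)
    (hcover : ∀ x ∈ V, ∃ i, x ∈ U i) (s : ∀ i, Γ(M, U i))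
    (hs : ∀ i j, res M (inf_le_left : U i ⊓ U j ≤ U i) (s i) =
      res M (inf_le_right : U i ⊓ U j ≤ U j) (s j)) : ∃ t : Γ(M, V), ∀ i, res M (hU i) t = s i := by
  obtain ⟨t, ht, -⟩ := TopCat.Sheaf.existsUnique_gluing' ⟨M.presheaf, M.isSheaf⟩ U V
    (fun i => homOfLE (hU i))
    (fun x hx => TopologicalSpace.Opens.mem_iSup.mpr (hcover x hx)) s hs
  exact ⟨t, ht⟩

lemma eq_of_res_eq_of_cover {ι : Type u} {V : X.Opens} (U : ι → X.Opens) (hU : ∀ i, U i ≤ V)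
    (hcover : ∀ x ∈ V, ∃ i, x ∈ U i) {s t : Γ(M, V)} (h : ∀ i, res M (hU i) s = res M (hU i) t) :
    s = t := by
  refine (TopCat.Sheaf.existsUnique_gluing' ⟨M.presheaf, M.isSheaf⟩ U V (fun i => homOfLE (hU i))
    (fun x hx => TopologicalSpace.Opens.mem_iSup.mpr (hcover x hx))
    (fun i => res M (hU i) t) ?_).unique h (fun _ => rfl)
  intro i j
  exact (res_res M _ _ t).trans (res_res M _ _ t).symm

lemma subsingleton_of_forall_notMem (h : ∀ x : X, x ∉ V) : Subsingleton Γ(M, V) :=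
  ⟨fun _ _ => eq_of_res_eq_of_cover M (ι := PEmpty) (fun i => i.elim) (fun i => i.elim)
    (fun x hx => (h x hx).elim) (fun i => i.elim)⟩

/-- A morphism of modules from compatible maps on sections. -/
def homOfSections {M N : X.Modules} (φ : ∀ U : X.Opens, Γ(M, U) →+ Γ(N, U))
    (hsmul : ∀ U (a : Γ(X, U)) s, φ U (a • s) = a • φ U s)
    (hres : ∀ U W (h : W ≤ U) s, φ W (res M h s) = res N h (φ U s)) : M ⟶ N :=
  (SheafOfModules.Hom.mk (PresheafOfModules.homMk (M₁ := M.val) (M₂ := N.val)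
    { app := fun U => AddCommGrpCat.ofHom (φ U.unop)
      naturality := fun U W i => by
        ext s
        exact hres U.unop W.unop i.unop.le s }
    (fun U a s => hsmul U.unop a s)) : SheafOfModules.Hom M N)

lemma isIso_of_bijective_app {M N : X.Modules} (φ : M ⟶ N)
    (h : ∀ U, Function.Bijective (φ.app U)) : IsIso φ :=
  Scheme.Modules.Hom.isIso_iff_isIso_app.mpr fun U =>
    (ConcreteCategory.isIso_iff_bijective _).mpr (h U)

variable [IsIntegral X]

/-- The value of a function in the function field. -/
def germη (U : X.Opens) (h : genericPoint X ∈ U) : Γ(X, U) →+* X.functionField :=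
  (X.presheaf.germ U (genericPoint X) h).hom

lemma germη_resO (h : W ≤ U) (hW : genericPoint X ∈ W) (a : Γ(X, U)) :
    germη W hW (resO h a) = germη U (h hW) a :=
  TopCat.Presheaf.germ_res_apply X.presheaf (homOfLE h) (genericPoint X) hW a

lemma germη_injective (h : genericPoint X ∈ U) : Function.Injective (germη U h) :=
  germ_injective_of_isIntegral X (genericPoint X) h

lemma resO_injective (h : W ≤ U) (hW : genericPoint X ∈ W) :
    Function.Injective (resO h : Γ(X, U) → Γ(X, W)) := fun a b hab => by
  apply germη_injective (h hW)
  rw [← germη_resO h hW, hab, germη_resO h hW]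

lemma mem_of_mem {x : X} (hx : x ∈ U) : genericPoint X ∈ U :=
  ((genericPoint_spec X).mem_open_set_iff U.isOpen).mpr ⟨x, trivial, hx⟩

lemma subsingleton_of_notMem (h : genericPoint X ∉ U) : Subsingleton Γ(M, U) :=
  subsingleton_of_forall_notMem M fun _ hx => h (mem_of_mem hx)

end Restriction

/-! ### Generators of line bundles -/

section Generator

variable {X : Scheme.{u}} {M : X.Modules} {U W : X.Opens}

/-- A section that generates `M` freely on `U`. -/
def IsGenerator (M : X.Modules) (U : X.Opens) (e : Γ(M, U)) : Prop :=
  ∀ (W : X.Opens) (h : W ≤ U), Function.Bijective (fun a : Γ(X, W) => a • res M h e)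

lemma isFrame_one_iff {e : Fin 1 → Γ(M, U)} : IsFrame M U e ↔ IsGenerator M U (e 0) := by
  refine forall₂_congr fun W h => ?_
  rw [← (Equiv.funUnique (Fin 1) Γ(X, W)).bijective.of_comp_iff]
  congr! 1
  ext a
  simp [res]

/-- Invariance of the number of basis elements over the nonzero ring of functions on the overlap. It
pins down the rank, which `HasDegree` leaves existential. -/
lemma IsFrame.eq_of_mem {r r' : ℕ} {e : Fin r → Γ(M, U)} {e' : Fin r' → Γ(M, W)}
    (he : IsFrame M U e) (he' : IsFrame M W e') {x : X} (hx : x ∈ U ⊓ W) : r = r' := by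
  have : Nonempty (U ⊓ W : X.Opens) := ⟨⟨x, hx⟩⟩
  let R := Γ(X, U ⊓ W)
  let l := LinearEquiv.ofBijective (Fintype.linearCombination R
    (fun i => M.presheaf.map (homOfLE (inf_le_left : U ⊓ W ≤ U)).op (e i))) (he _ _)
  let l' := LinearEquiv.ofBijective (Fintype.linearCombination R
    (fun i => M.presheaf.map (homOfLE (inf_le_right : U ⊓ W ≤ W)).op (e' i))) (he' _ _)
  exact eq_of_fin_equiv R (l.trans l'.symm)

end Generator

/-! ### Line bundles inside the function field -/

section RationalTrivialization

variable {X : Scheme.{u}} [IsIntegral X] [AlgebraicGeometry.IsNoetherian X]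

variable (X) in
/-- The closed points of `X`. -/
abbrev ClosedPoint : Type u := {x : X // IsClosed ({x} : Set X)}

/-- `z` is a section over `U` of the sheaf of functions with poles bounded by `D`. -/
def IsRegularOn (D : ClosedPoint X →₀ ℤ) (U : X.Opens) (z : X.functionField) : Prop :=
  z ≠ 0 → ∀ P : ClosedPoint X, P.1 ∈ U → -D P ≤ Scheme.ord z P.1

/-- An isomorphism of `M` with the sheaf of functions with poles bounded by `D`. -/
structure RationalTrivialization (M : X.Modules) (D : ClosedPoint X →₀ ℤ) where
  /-- The rational function corresponding to a section. -/
  coord : ∀ U : X.Opens, genericPoint X ∈ U → Γ(M, U) →+ X.functionField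
  coord_smul : ∀ U hU (a : Γ(X, U)) s, coord U hU (a • s) = germη U hU a * coord U hU s
  coord_res : ∀ U W (h : W ≤ U) hW s, coord W hW (res M h s) = coord U (h hW) s
  coord_injective : ∀ U hU, Function.Injective (coord U hU)
  exists_coord_eq_iff : ∀ U hU z, (∃ s, coord U hU s = z) ↔ IsRegularOn D U z

variable {M N : X.Modules} {D E : ClosedPoint X →₀ ℤ}

/-- Transport along an isomorphism. -/
def RationalTrivialization.congr (c : RationalTrivialization M D) (α : N ≅ M) :
    RationalTrivialization N D where
  coord U hU := (c.coord U hU).comp (α.hom.app U).hom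
  coord_smul U hU a s := by
    refine Eq.trans ?_ (c.coord_smul U hU a _)
    exact congrArg (c.coord U hU) (α.hom.app_smul a s)
  coord_res U W h hW s := by
    refine Eq.trans ?_ (c.coord_res U W h hW _)
    exact congrArg (c.coord W hW) (res_app α.hom h s).symm
  coord_injective U hU := (c.coord_injective U hU).comp
    (ConcreteCategory.bijective_of_isIso (α.hom.app U)).1
  exists_coord_eq_iff U hU z := by
    rw [← c.exists_coord_eq_iff U hU]
    exact ((ConcreteCategory.bijective_of_isIso (α.hom.app U)).2.exists
      (p := fun s => c.coord U hU s = z)).symm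

variable [hX : IsRegularCurve X]

omit hX in
lemma ord_one (x : X) : Scheme.ord (1 : X.functionField) x = 0 := by
  have h := Scheme.ord_mul (x := x) (one_ne_zero (α := X.functionField)) one_ne_zero
  rw [mul_one] at h
  omega

omit hX in
lemma ord_inv {z : X.functionField} (hz : z ≠ 0) (x : X) :
    Scheme.ord z⁻¹ x = -Scheme.ord z x := by
  have h := Scheme.ord_mul (x := x) hz (inv_ne_zero hz)
  rw [mul_inv_cancel₀ hz, ord_one] at h
  omega

/-- The divisor `div z` on the closed points. -/
def principal (z : X.functionField) (hz : z ≠ 0) : ClosedPoint X →₀ ℤ :=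
  Finsupp.ofSupportFinite (fun P => Scheme.ord z P.1)
    ((finite_ord_ne_zero hz).preimage Subtype.val_injective.injOn)

lemma principal_apply (z : X.functionField) (hz : z ≠ 0) (P : ClosedPoint X) :
    principal z hz P = Scheme.ord z P.1 := rfl

lemma isRegularOn_mul_iff {φ z : X.functionField} (hφ : φ ≠ 0) {U : X.Opens} :
    IsRegularOn (D - principal φ hφ) U (φ * z) ↔ IsRegularOn D U z := by
  unfold IsRegularOn
  rw [mul_ne_zero_iff_left hφ]
  refine forall_congr' fun hz => forall₂_congr fun P _ => ?_
  rw [Scheme.ord_mul hφ hz, Finsupp.sub_apply, principal_apply]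
  omega

namespace RationalTrivialization

variable (c : RationalTrivialization M D)

omit hX in
lemma exists_coord_eq {U : X.Opens} (hU : genericPoint X ∈ U) {z : X.functionField}
    (h : IsRegularOn D U z) : ∃ s, c.coord U hU s = z := (c.exists_coord_eq_iff U hU z).mpr h

omit hX in
lemma isRegularOn_coord {U : X.Opens} (hU : genericPoint X ∈ U) (s : Γ(M, U)) :
    IsRegularOn D U (c.coord U hU s) := (c.exists_coord_eq_iff U hU _).mp ⟨s, rfl⟩

/-- Isomorphisms given by multiplication by a rational function. -/
lemma exists_iso {φ : X.functionField} (hφ : φ ≠ 0)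
    (hE : E = D - principal φ hφ) (c' : RationalTrivialization N E) :
    ∃ α : M ≅ N, ∀ U hU s, c'.coord U hU (α.hom.app U s) = φ * c.coord U hU s := by
  classical
  subst hE
  have hex : ∀ (U : X.Opens) (hU : genericPoint X ∈ U) (s : Γ(M, U)),
      ∃ t : Γ(N, U), c'.coord U hU t = φ * c.coord U hU s := fun U hU s =>
    c'.exists_coord_eq hU ((isRegularOn_mul_iff hφ).mpr (c.isRegularOn_coord hU s))
  choose g hg using hex
  -- An open set without the generic point is empty and has only the zero section, so the default
  -- value is harmless.
  let m (U : X.Opens) : Γ(M, U) →+ Γ(N, U) :=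
    if hU : genericPoint X ∈ U then
      { toFun := g U hU
        map_zero' := c'.coord_injective U hU (by rw [hg]; simp)
        map_add' := fun s t => c'.coord_injective U hU (by
          rw [hg, map_add, map_add, hg, hg, mul_add]) }
    else 0
  have hm : ∀ U hU s, c'.coord U hU (m U s) = φ * c.coord U hU s := by
    intro U hU s
    simp only [m, dif_pos hU]
    exact hg U hU s
  let ψ : M ⟶ N := homOfSections m
    (fun U a s => by
      by_cases hU : genericPoint X ∈ U
      · apply c'.coord_injective U hU
        rw [hm, c.coord_smul, c'.coord_smul, hm]
        ring
      · have := subsingleton_of_notMem N hU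
        exact Subsingleton.elim _ _)
    (fun U W h s => by
      by_cases hW : genericPoint X ∈ W
      · apply c'.coord_injective W hW
        rw [hm, c.coord_res, c'.coord_res, hm]
      · have := subsingleton_of_notMem N hW
        exact Subsingleton.elim _ _)
  have hψ : ∀ U hU s, c'.coord U hU (ψ.app U s) = φ * c.coord U hU s := hm
  have : IsIso ψ := isIso_of_bijective_app ψ fun U => by
    by_cases hU : genericPoint X ∈ U
    · refine ⟨fun s t hst => ?_, fun t => ?_⟩
      · have h := congrArg (c'.coord U hU) hst
        rw [hψ, hψ] at h
        exact c.coord_injective U hU (mul_left_cancel₀ hφ h)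
      · have h := c'.isRegularOn_coord hU t
        rw [← mul_inv_cancel_left₀ hφ (c'.coord U hU t), isRegularOn_mul_iff] at h
        obtain ⟨s, hs⟩ := c.exists_coord_eq hU h
        refine ⟨s, c'.coord_injective U hU ?_⟩
        rw [hψ, hs, mul_inv_cancel_left₀ hφ]
    · have := subsingleton_of_notMem M hU
      have := subsingleton_of_notMem N hU
      exact ⟨fun _ _ _ => Subsingleton.elim _ _, fun _ => ⟨0, Subsingleton.elim _ _⟩⟩
  exact ⟨asIso ψ, hψ⟩

/-- A section whose divisor is as small as possible is a generator. -/
lemma isGenerator {U : X.Opens} (hU : genericPoint X ∈ U) {e : Γ(M, U)}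
    (he : c.coord U hU e ≠ 0)
    (h : ∀ P : ClosedPoint X, P.1 ∈ U → Scheme.ord (c.coord U hU e) P.1 = -D P) :
    IsGenerator M U e := by
  intro W hWU
  by_cases hW : genericPoint X ∈ W
  · refine ⟨fun a b hab => germη_injective hW ?_, fun t => ?_⟩
    · have h1 := congrArg (c.coord W hW) hab
      simp only [c.coord_smul, c.coord_res] at h1
      exact mul_right_cancel₀ he h1
    · obtain ⟨a, ha⟩ := exists_germ_eq_of_ord_nonneg hW
        (z := c.coord W hW t / c.coord U hU e) (by
          intro h0 x hx
          by_cases hxη : x = genericPoint X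
          · exact hxη ▸ (ord_genericPoint _).ge
          have ht : c.coord W hW t ≠ 0 := fun h => h0 (by rw [h, zero_div])
          have h1 := c.isRegularOn_coord hW t ht ⟨x, isClosed_of_ne_genericPoint hxη⟩ hx
          have h2 := h ⟨x, isClosed_of_ne_genericPoint hxη⟩ (hWU hx)
          rw [div_eq_mul_inv, Scheme.ord_mul ht (inv_ne_zero he), ord_inv he]
          simp only at h1 h2
          omega)
      refine ⟨a, c.coord_injective W hW ?_⟩
      simp only [c.coord_smul, c.coord_res]
      rw [show germη W hW a = _ from ha, div_mul_cancel₀ _ he]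
  · have := subsingleton_of_notMem M hW
    have : IsEmpty W := ⟨fun x => hW (mem_of_mem x.2)⟩
    have : Subsingleton Γ(X, W) := by
      rw [show W = ⊥ from TopologicalSpace.Opens.ext (Set.isEmpty_coe_sort.mp this)]
      infer_instance
    exact ⟨fun _ _ _ => Subsingleton.elim _ _, fun _ => ⟨0, Subsingleton.elim _ _⟩⟩

/-- Take `z` of order `-D` at `y` and remove the finitely many other closed points where `D` or `div
z` is nonzero. At the generic point `z = 1` is allowed; this normalization lets proportionality
factors be read off later. -/
lemma exists_generator (y : X) : ∃ (U : X.Opens) (_ : y ∈ U) (hU : genericPoint X ∈ U)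
    (e : Γ(M, U)), c.coord U hU e ≠ 0 ∧ IsGenerator M U e ∧
      (∀ P : ClosedPoint X, P.1 ∈ U → Scheme.ord (c.coord U hU e) P.1 = -D P) ∧
      (y = genericPoint X → c.coord U hU e = 1) := by
  obtain ⟨z, hz0, hz, hz1⟩ : ∃ z : X.functionField, z ≠ 0 ∧
      (∀ P : ClosedPoint X, P.1 = y → Scheme.ord z y = -D P) ∧ (y = genericPoint X → z = 1) := by
    by_cases hy : y = genericPoint X
    · exact ⟨1, one_ne_zero, fun P hP => absurd (hP.trans hy) (isClosed_singleton_iff.mp P.2),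
        fun _ => rfl⟩
    · obtain ⟨π, hπ0, hπ⟩ := exists_ord_eq_one hy
      obtain ⟨w, hw0, hw⟩ : ∃ w : X.functionField, w ≠ 0 ∧
          Scheme.ord w y = -D ⟨y, isClosed_of_ne_genericPoint hy⟩ := by
        generalize -D ⟨y, isClosed_of_ne_genericPoint hy⟩ = m
        have hpow : ∀ n : ℕ, Scheme.ord (π ^ n) y = n := by
          intro n
          induction n with
          | zero => rw [pow_zero, ord_one, Nat.cast_zero]
          | succ n ih =>
            rw [pow_succ, Scheme.ord_mul (pow_ne_zero n hπ0) hπ0, ih, hπ]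
            push_cast
            rfl
        obtain ⟨n, rfl | rfl⟩ := m.eq_nat_or_neg
        · exact ⟨π ^ n, pow_ne_zero n hπ0, hpow n⟩
        · exact ⟨(π ^ n)⁻¹, inv_ne_zero (pow_ne_zero n hπ0), by
            rw [ord_inv (pow_ne_zero n hπ0), hpow]⟩
      refine ⟨w, hw0, ?_, fun h => absurd h hy⟩
      rintro ⟨P, hP⟩ rfl
      exact hw
  let S : Set X := Subtype.val '' {P : ClosedPoint X | P.1 ≠ y ∧ (D P ≠ 0 ∨ Scheme.ord z P.1 ≠ 0)}
  have hS : S.Finite := by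
    refine Set.Finite.image _ (Set.Finite.subset (D.hasFiniteSupport.union
      (principal z hz0).hasFiniteSupport) ?_)
    rintro P ⟨-, h⟩
    exact h
  have hη : genericPoint X ∉ S := by
    rintro ⟨P, -, hP⟩
    exact isClosed_singleton_iff.mp P.2 hP
  have hyS : y ∉ S := by
    rintro ⟨P, ⟨h, -⟩, hP⟩
    exact h hP
  let U := complOfFinite S hS hη
  have hord : ∀ P : ClosedPoint X, P.1 ∈ U → Scheme.ord z P.1 = -D P := by
    intro P hP
    by_cases hPy : P.1 = y
    · rw [hPy]
      exact hz P hPy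
    · have h : ¬ (D P ≠ 0 ∨ Scheme.ord z P.1 ≠ 0) := fun h => hP ⟨P, ⟨hPy, h⟩, rfl⟩
      push Not at h
      rw [h.1, h.2, neg_zero]
  obtain ⟨e, he⟩ := c.exists_coord_eq (U := U) hη (z := z) fun _ P hP => (hord P hP).ge
  have he' : ∀ P : ClosedPoint X, P.1 ∈ U → Scheme.ord (c.coord U hη e) P.1 = -D P := by
    rw [he]
    exact hord
  have he0 : c.coord U hη e ≠ 0 := by rwa [he]
  exact ⟨U, hyS, hη, e, he0, c.isGenerator hη he0 he', he', fun h => by rw [he, hz1 h]⟩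

/-- Two trivializations of the same line bundle are proportional. -/
lemma exists_coord_eq_mul (c' : RationalTrivialization M E) :
    ∃ (φ : X.functionField) (hφ : φ ≠ 0), E = D - principal φ hφ ∧
      ∀ U hU s, c'.coord U hU s = φ * c.coord U hU s := by
  obtain ⟨U₀, -, hU₀, e, he0, he, -, he1⟩ := c.exists_generator (genericPoint X)
  have he1 := he1 rfl
  have hφ : c'.coord U₀ hU₀ e ≠ 0 := by
    rw [← map_zero (c'.coord U₀ hU₀)]
    refine (c'.coord_injective U₀ hU₀).ne ?_
    rintro rfl
    exact he0 (map_zero _)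
  have hmul : ∀ U hU s, c'.coord U hU s = c'.coord U₀ hU₀ e * c.coord U hU s := by
    intro U hU s
    have hW : genericPoint X ∈ U ⊓ U₀ := ⟨hU, hU₀⟩
    obtain ⟨b, hb⟩ := (he (U ⊓ U₀) inf_le_right).2 (res M inf_le_left s)
    have h1 := congrArg (c.coord _ hW) hb
    have h2 := congrArg (c'.coord _ hW) hb
    simp only [coord_smul, coord_res] at h1 h2
    rw [← h1, ← h2, he1, mul_one, mul_comm]
  -- At each closed point, a generator for `c` gives one inequality between the two divisors and a
  -- generator for `c'` gives the other.
  refine ⟨_, hφ, ?_, hmul⟩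
  ext P
  obtain ⟨U, hPU, hU, t, ht0, ht, htP, -⟩ := c.exists_generator P.1
  obtain ⟨U', hPU', hU', t', ht0', ht', htP', -⟩ := c'.exists_generator P.1
  rw [Finsupp.sub_apply, principal_apply]
  have h1 := c'.isRegularOn_coord hU t (by rw [hmul]; exact mul_ne_zero hφ ht0) P hPU
  have ht0'' : c.coord U' hU' t' ≠ 0 := fun h => ht0' (by rw [hmul, h, mul_zero])
  have h2 := c.isRegularOn_coord hU' t' ht0'' P hPU'
  have h3 := htP P hPU
  have h4 := htP' P hPU'
  rw [hmul, Scheme.ord_mul hφ ht0] at h1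
  rw [hmul, Scheme.ord_mul hφ ht0''] at h4
  omega

theorem isVectorBundle (c : RationalTrivialization M D) : IsVectorBundle M 1 := fun y => by
  obtain ⟨U, hy, hU, e, -, he, -⟩ := c.exists_generator y
  exact ⟨U, hy, fun _ => e, isFrame_one_iff.mpr he⟩

end RationalTrivialization

end RationalTrivialization

/-! ### The line bundle of a divisor -/

section LineBundle

variable {X : Scheme.{u}} [IsIntegral X] [AlgebraicGeometry.IsNoetherian X] [hX : IsRegularCurve X]
variable {D : ClosedPoint X →₀ ℤ} {U W : X.Opens} {z w : X.functionField}

omit hX in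
lemma IsRegularOn.zero : IsRegularOn D U 0 := fun h => absurd rfl h

omit hX in
lemma IsRegularOn.mono (h : W ≤ U) (hz : IsRegularOn D U z) : IsRegularOn D W z :=
  fun h0 P hP => hz h0 P (h hP)

lemma IsRegularOn.add (hz : IsRegularOn D U z) (hw : IsRegularOn D U w) :
    IsRegularOn D U (z + w) := by
  intro h P hP
  by_cases hz0 : z = 0
  · rw [hz0, zero_add] at h ⊢
    exact hw h P hP
  by_cases hw0 : w = 0
  · rw [hw0, add_zero] at h ⊢
    exact hz h P hP
  have := isDiscreteValuationRing_stalk (isClosed_singleton_iff.mp P.2)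
  exact (le_min (hz hz0 P hP) (hw hw0 P hP)).trans (Scheme.ord_add h)

lemma IsRegularOn.germη_mul (hU : genericPoint X ∈ U) (a : Γ(X, U)) (hz : IsRegularOn D U z) :
    IsRegularOn D U (germη U hU a * z) := by
  intro h P hP
  have h1 := left_ne_zero_of_mul h
  have h2 := right_ne_zero_of_mul h
  rw [Scheme.ord_mul h1 h2]
  have := ord_germ_nonneg hU a hP
  have h3 := hz h2 P hP
  change 0 ≤ Scheme.ord (germη U hU a) P.1 at this
  omega

lemma IsRegularOn.neg (hz : IsRegularOn D U z) : IsRegularOn D U (-z) := by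
  by_cases hU : genericPoint X ∈ U
  · have := hz.germη_mul hU (-1)
    rwa [map_neg, map_one, neg_one_mul] at this
  · exact fun _ P hP => absurd (mem_of_mem hP) hU

variable (D U) in
/-- The functions on `U` with poles bounded by `D`; there is only the zero function if `U` is
empty. -/
def regularFunctions : AddSubgroup (PLift (genericPoint X ∈ U) → X.functionField) where
  carrier := {g | ∀ h, IsRegularOn D U (g h)}
  zero_mem' _ := IsRegularOn.zero
  add_mem' hg hg' h := (hg h).add (hg' h)
  neg_mem' hg h := (hg h).neg

instance : Module Γ(X, U) (regularFunctions D U) where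
  smul a g := ⟨fun h => germη U h.down a * g.1 h, fun h => (g.2 h).germη_mul h.down a⟩
  one_smul g := Subtype.ext (funext fun h => by
    change germη U h.down 1 * g.1 h = g.1 h
    rw [map_one, one_mul])
  mul_smul a b g := Subtype.ext (funext fun h => by
    change germη U h.down (a * b) * g.1 h = germη U h.down a * (germη U h.down b * g.1 h)
    rw [map_mul, mul_assoc])
  smul_zero a := Subtype.ext (funext fun h => mul_zero _)
  smul_add a g g' := Subtype.ext (funext fun h => mul_add _ _ _)
  add_smul a b g := Subtype.ext (funext fun h => by
    change germη U h.down (a + b) * g.1 h = germη U h.down a * g.1 h + germη U h.down b * g.1 h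
    rw [map_add, add_mul])
  zero_smul g := Subtype.ext (funext fun h => by
    change germη U h.down 0 * g.1 h = 0
    rw [map_zero, zero_mul])

/-- Restriction of functions with bounded poles. -/
def regularFunctionsRes (h : W ≤ U) : regularFunctions D U →+ regularFunctions D W where
  toFun g := ⟨fun hW => g.1 ⟨h hW.down⟩, fun hW => (g.2 ⟨h hW.down⟩).mono h⟩
  map_zero' := rfl
  map_add' _ _ := rfl

variable (D) in
/-- The presheaf of functions with poles bounded by `D`. -/
def regularPresheaf : TopCat.Presheaf Ab.{u} X where
  obj U := AddCommGrpCat.of (regularFunctions D U.unop)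
  map i := AddCommGrpCat.ofHom (regularFunctionsRes i.unop.le)

/-- A section on a nonempty open set is a single rational function. Any two nonempty members of a
cover share the generic point, so compatible sections are the same function, and the pole condition
is pointwise. -/
lemma isSheaf_regularPresheaf : (regularPresheaf D).IsSheaf := by
  rw [TopCat.Presheaf.isSheaf_iff_isSheaf_comp (forget Ab)]
  apply TopCat.Presheaf.isSheaf_of_isSheafUniqueGluing_types
  intro ι V s hs
  let s' : ∀ i, regularFunctions D (V i) := s
  have hs' : ∀ (i j : ι) (hi : genericPoint X ∈ V i) (hj : genericPoint X ∈ V j),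
      (s' i).1 ⟨hi⟩ = (s' j).1 ⟨hj⟩ := by
    intro i j hi hj
    have h : regularFunctionsRes (inf_le_left : V i ⊓ V j ≤ V i) (s' i) =
        regularFunctionsRes (inf_le_right : V i ⊓ V j ≤ V j) (s' j) := hs i j
    exact congrFun (congrArg Subtype.val h) ⟨hi, hj⟩
  have hreg : ∀ z, (∀ j hj, (s' j).1 ⟨hj⟩ = z) → IsRegularOn D (iSup V) z := by
    intro z hz h0 P hP
    obtain ⟨j, hj⟩ := TopologicalSpace.Opens.mem_iSup.mp hP
    have h := (s' j).2 ⟨mem_of_mem hj⟩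
    rw [hz] at h
    exact h h0 P hj
  have hex : ∀ h : PLift (genericPoint X ∈ iSup V), ∃ i, genericPoint X ∈ V i := fun h =>
    TopologicalSpace.Opens.mem_iSup.mp h.down
  choose i hi using hex
  let t : regularFunctions D (iSup V) :=
    ⟨fun h => (s' (i h)).1 ⟨hi h⟩, fun h => hreg _ fun j hj => hs' j (i h) hj (hi h)⟩
  refine ⟨t, fun j => Subtype.ext (funext fun h => hs' _ _ _ h.down), fun t' ht' => ?_⟩
  refine Subtype.ext (funext fun h => ?_)
  have := congrFun (congrArg Subtype.val (ht' (i h))) ⟨hi h⟩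
  exact this

variable (D) in
/-- The line bundle `𝒪(D)`. -/
def lineBundle : X.Modules :=
  letI (U : (TopologicalSpace.Opens X)ᵒᵖ) :
      Module (X.ringCatSheaf.obj.obj U) ((regularPresheaf D).obj U) :=
    inferInstanceAs (Module Γ(X, U.unop) (regularFunctions D U.unop))
  (SheafOfModules.mk (PresheafOfModules.ofPresheaf (R := X.ringCatSheaf.obj) (regularPresheaf D)
    fun U W i a g => Subtype.ext (funext fun h => by
      exact congrArg (· * _) (germη_resO i.unop.le h.down a).symm))
    isSheaf_regularPresheaf : SheafOfModules X.ringCatSheaf)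

variable (D) in
/-- The line bundle `𝒪(D)` consists of rational functions. -/
def lineBundleTrivialization : RationalTrivialization (lineBundle D) D where
  coord U hU :=
    { toFun := fun g => (show regularFunctions D U from g).1 ⟨hU⟩
      map_zero' := rfl
      map_add' := fun _ _ => rfl }
  coord_smul _ _ _ _ := rfl
  coord_res _ _ _ _ _ := rfl
  coord_injective _ _ _ _ h := Subtype.ext (funext fun _ => h)
  exists_coord_eq_iff U hU z :=
    ⟨fun ⟨g, hg⟩ => hg ▸ (show regularFunctions D U from g).2 ⟨hU⟩,
      fun h => ⟨⟨fun _ => z, fun _ => h⟩, rfl⟩⟩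

end LineBundle

/-! ### Rational sections of line bundles -/

section RationalSection

variable {X : Scheme.{u}} [IsIntegral X] [AlgebraicGeometry.IsNoetherian X]
variable {M : X.Modules}

lemma hasOrderAt_one_iff {U : X.Opens} (hU : genericPoint X ∈ U) (e : Fin 1 → Γ(M, U)) (x : X)
    (n : ℤ) : HasOrderAt M hU e x n ↔ ∃ (W : X.Opens) (_ : x ∈ W) (hW : genericPoint X ∈ W)
      (f : Γ(M, W)) (a : Γ(X, U ⊓ W)), IsGenerator M W f ∧
      res M inf_le_left (e 0) = a • res M inf_le_right f ∧
      Scheme.ord (germη (U ⊓ W) ⟨hU, hW⟩ a) x = n := by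
  refine exists_congr fun W => exists_congr fun _ => exists_congr fun hW => ⟨?_, ?_⟩
  · rintro ⟨f, A, hf, hA, h⟩
    refine ⟨f 0, A 0 0, isFrame_one_iff.mp hf, ?_, ?_⟩
    · exact (hA 0).trans (Fin.sum_univ_one _)
    · rw [Matrix.det_fin_one] at h
      exact h
  · rintro ⟨f, a, hf, ha, h⟩
    refine ⟨fun _ => f, fun _ _ => a, isFrame_one_iff.mpr hf, fun i => ?_, ?_⟩
    · rw [Fin.sum_univ_one, Subsingleton.elim i 0]
      exact ha
    · have h1 : Matrix.det (fun _ _ : Fin 1 => a) = a := Matrix.det_fin_one _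
      exact (congrArg (fun b => Scheme.ord (germη (U ⊓ W) ⟨hU, hW⟩ b) x) h1).trans h

variable {U V W : X.Opens} {e : Γ(M, U)} {f : Γ(M, W)} {a : Γ(X, U ⊓ W)}

omit [AlgebraicGeometry.IsNoetherian X] [IsIntegral X] in
/-- The transition function between two generators is a unit. -/
lemma IsGenerator.isUnit (he : IsGenerator M U e) (hf : IsGenerator M W f)
    (ha : res M inf_le_left e = a • res M inf_le_right f) : IsUnit a := by
  obtain ⟨b, hb⟩ := (he (U ⊓ W) inf_le_left).2 (res M inf_le_right f)
  refine IsUnit.of_mul_eq_one b ((hf (U ⊓ W) inf_le_right).1 ?_)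
  simp only at hb ⊢
  rw [mul_comm, mul_smul, ← ha, hb, one_smul]

omit [AlgebraicGeometry.IsNoetherian X] in
lemma IsGenerator.transition_ne_zero (he : IsGenerator M U e) (hU : genericPoint X ∈ U)
    (hW : genericPoint X ∈ W) (ha : res M inf_le_left e = a • res M inf_le_right f) :
    germη (U ⊓ W) ⟨hU, hW⟩ a ≠ 0 := by
  rintro h0
  rw [← map_zero (germη (U ⊓ W) ⟨hU, hW⟩)] at h0
  have h0 := germη_injective _ h0
  have : Nonempty (U ⊓ W : X.Opens) := ⟨⟨genericPoint X, hU, hW⟩⟩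
  refine one_ne_zero (α := Γ(X, U ⊓ W)) ((he (U ⊓ W) inf_le_left).1 ?_)
  simp only
  rw [ha, h0, zero_smul, smul_zero, smul_zero]

end RationalSection

/-! ### Coordinates with respect to a generator -/

section RationalSection

variable {X : Scheme.{u}} [IsIntegral X] {M : X.Modules} {U V W : X.Opens} {e : Γ(M, U)}

/-- The quotient of a section by a generator, as a rational function. -/
def IsGenerator.quot (he : IsGenerator M U e) (hU : genericPoint X ∈ U)
    (hV : genericPoint X ∈ V) (s : Γ(M, V)) : X.functionField :=
  germη (V ⊓ U) ⟨hV, hU⟩ ((he (V ⊓ U) inf_le_right).2 (res M inf_le_left s)).choose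

lemma IsGenerator.quot_eq (he : IsGenerator M U e) (hU : genericPoint X ∈ U)
    (hV : genericPoint X ∈ V) {s : Γ(M, V)} (hWV : W ≤ V) (hWU : W ≤ U) (hW : genericPoint X ∈ W)
    {b : Γ(X, W)} (hb : b • res M hWU e = res M hWV s) : he.quot hU hV s = germη W hW b := by
  have h := ((he (V ⊓ U) inf_le_right).2 (res M inf_le_left s)).choose_spec
  have h' := congrArg (res M (le_inf hWV hWU)) h
  simp only [res_smul, res_res] at h'
  rw [← hb] at h'
  rw [IsGenerator.quot, ← (he W hWU).1 h', germη_resO]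

lemma IsGenerator.exists_smul_eq (he : IsGenerator M U e) (hU : genericPoint X ∈ U)
    (hV : genericPoint X ∈ V) (s : Γ(M, V)) : ∃ b : Γ(X, V ⊓ U),
      b • res M inf_le_right e = res M inf_le_left s ∧
        he.quot hU hV s = germη (V ⊓ U) ⟨hV, hU⟩ b :=
  ⟨_, ((he (V ⊓ U) inf_le_right).2 (res M inf_le_left s)).choose_spec, rfl⟩

lemma IsGenerator.quot_add (he : IsGenerator M U e) (hU : genericPoint X ∈ U)
    (hV : genericPoint X ∈ V) (s t : Γ(M, V)) :
    he.quot hU hV (s + t) = he.quot hU hV s + he.quot hU hV t := by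
  obtain ⟨b, hb, hb'⟩ := he.exists_smul_eq hU hV s
  obtain ⟨c, hc, hc'⟩ := he.exists_smul_eq hU hV t
  rw [hb', hc', ← map_add]
  exact he.quot_eq hU hV _ _ _ (by rw [add_smul, hb, hc, map_add])

lemma IsGenerator.quot_smul (he : IsGenerator M U e) (hU : genericPoint X ∈ U)
    (hV : genericPoint X ∈ V) (a : Γ(X, V)) (s : Γ(M, V)) :
    he.quot hU hV (a • s) = germη V hV a * he.quot hU hV s := by
  obtain ⟨b, hb, hb'⟩ := he.exists_smul_eq hU hV s
  rw [hb', ← germη_resO inf_le_left (⟨hV, hU⟩ : genericPoint X ∈ V ⊓ U), ← map_mul]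
  exact he.quot_eq hU hV _ _ _ (by rw [mul_smul, hb, res_smul])

lemma IsGenerator.quot_res (he : IsGenerator M U e) (hU : genericPoint X ∈ U)
    (hV : genericPoint X ∈ V) (h : W ≤ V) (hW : genericPoint X ∈ W) (s : Γ(M, V)) :
    he.quot hU hW (res M h s) = he.quot hU hV s := by
  obtain ⟨b, hb, hb'⟩ := he.exists_smul_eq hU hW (res M h s)
  rw [hb']
  exact (he.quot_eq hU hV (inf_le_left.trans h) inf_le_right ⟨hW, hU⟩
    (hb.trans (res_res M _ _ _))).symm

/-- The bundle is generated near every point by one section. -/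
def IsLocallyGenerated (M : X.Modules) : Prop :=
  ∀ x : X, ∃ (U : X.Opens) (_ : x ∈ U) (e : Γ(M, U)), IsGenerator M U e

/-- Local generators reduce this to injectivity of restriction for functions on an integral scheme.
-/
lemma eq_of_res_eq (hM : IsLocallyGenerated M) (h : W ≤ V) (hW : genericPoint X ∈ W)
    {s t : Γ(M, V)} (hst : res M h s = res M h t) : s = t := by
  choose N hxN f hf using hM
  refine eq_of_res_eq_of_cover M (fun x : V => V ⊓ N x) (fun _ => inf_le_left)
    (fun x hx => ⟨⟨x, hx⟩, hx, hxN x⟩) fun x => ?_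
  obtain ⟨a, ha⟩ := (hf x (V ⊓ N x) inf_le_right).2 (res M inf_le_left s)
  obtain ⟨b, hb⟩ := (hf x (V ⊓ N x) inf_le_right).2 (res M inf_le_left t)
  simp only at ha hb
  have hη : genericPoint X ∈ W ⊓ (V ⊓ N x) := ⟨hW, h hW, mem_of_mem (hxN x)⟩
  rw [← ha, ← hb]
  congr 1
  apply resO_injective inf_le_right hη
  apply (hf x (W ⊓ (V ⊓ N x)) (inf_le_right.trans inf_le_right)).1
  have ha' := congrArg (res M (inf_le_right : W ⊓ (V ⊓ N x) ≤ _)) ha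
  have hb' := congrArg (res M (inf_le_right : W ⊓ (V ⊓ N x) ≤ _)) hb
  rw [res_smul, res_res, res_res] at ha' hb'
  simp only
  rw [ha', hb', ← res_res M (inf_le_left : W ⊓ (V ⊓ N x) ≤ W) h, hst, res_res]

lemma IsGenerator.quot_injective (hM : IsLocallyGenerated M) (he : IsGenerator M U e)
    (hU : genericPoint X ∈ U) (hV : genericPoint X ∈ V) :
    Function.Injective (he.quot hU hV) := by
  intro s t hst
  obtain ⟨b, hb, hb'⟩ := he.exists_smul_eq hU hV s
  obtain ⟨c, hc, hc'⟩ := he.exists_smul_eq hU hV t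
  rw [hb', hc'] at hst
  refine eq_of_res_eq hM inf_le_left (⟨hV, hU⟩ : genericPoint X ∈ V ⊓ U) ?_
  rw [← hb, ← hc, germη_injective _ hst]

variable {f : Γ(M, W)} {a : Γ(X, U ⊓ W)}

/-- Change of generator: `e = a f` gives `c f = (c / a) e`. -/
lemma IsGenerator.quot_smul_res (he : IsGenerator M U e) (hU : genericPoint X ∈ U)
    (hf : IsGenerator M W f) (hW : genericPoint X ∈ W)
    (ha : res M inf_le_left e = a • res M inf_le_right f) (hVW : V ≤ W) (hV : genericPoint X ∈ V)
    (c : Γ(X, V)) :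
    he.quot hU hV (c • res M hVW f) * germη (U ⊓ W) ⟨hU, hW⟩ a = germη V hV c := by
  obtain ⟨b, hb, hb'⟩ := he.exists_smul_eq hU hV (c • res M hVW f)
  have hη : genericPoint X ∈ V ⊓ U := ⟨hV, hU⟩
  have hle : V ⊓ U ≤ U ⊓ W := le_inf inf_le_right (inf_le_left.trans hVW)
  rw [hb', ← germη_resO hle hη, ← map_mul, ← germη_resO inf_le_left hη c]
  congr 1
  apply (hf (V ⊓ U) (inf_le_left.trans hVW)).1
  have ha' := congrArg (res M hle) ha
  rw [res_smul, res_res, res_res] at ha'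
  simp only
  rw [mul_smul, ← ha', hb, res_smul, res_res]

end RationalSection

/-! ### The divisor of a rational section -/

section Order

variable {X : Scheme.{u}} [IsIntegral X] [AlgebraicGeometry.IsNoetherian X] [hX : IsRegularCurve X]
  {M : X.Modules} {U V : X.Opens} {e : Fin 1 → Γ(M, U)}

/-- At a point of `U` the transition function between two generators is a unit; at the generic point
the order is `0` by convention. -/
lemma hasOrderAt_eq_zero (he : IsGenerator M U (e 0)) {hU : genericPoint X ∈ U} {x : X} {n : ℤ}
    (h : HasOrderAt M hU e x n) (hx : x ∈ U ∨ x = genericPoint X) : n = 0 := by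
  obtain ⟨W, hxW, hW, f, a, hf, ha, rfl⟩ := (hasOrderAt_one_iff hU e x n).mp h
  obtain hx | rfl := hx
  · have : Nonempty (U ⊓ W : X.Opens) := ⟨⟨x, hx, hxW⟩⟩
    exact Scheme.ord_of_isUnit (he.isUnit hf ha) ⟨hx, hxW⟩
  · exact ord_genericPoint _

/-- A line bundle with a rational section is isomorphic to the line bundle of the divisor of this
section. -/
def trivializationOfGenerator (hM : IsLocallyGenerated M) (he : IsGenerator M U (e 0))
    (hU : genericPoint X ∈ U) (D : ClosedPoint X →₀ ℤ) (n : X → ℤ)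
    (hn : ∀ x, HasOrderAt M hU e x (n x)) (hD : ∀ P, D P = n P.1) :
    RationalTrivialization M D where
  coord V hV :=
    { toFun := he.quot hU hV
      map_zero' := (he.quot_eq hU hV (inf_le_left : V ⊓ U ≤ V) inf_le_right ⟨hV, hU⟩ (b := 0)
        (by rw [zero_smul, map_zero])).trans (map_zero _)
      map_add' := he.quot_add hU hV }
  coord_smul V hV := he.quot_smul hU hV
  coord_res V W h hW := he.quot_res hU (h hW) h hW
  coord_injective V hV := he.quot_injective hM hU hV
  exists_coord_eq_iff V hV z := by
    change (∃ s, he.quot hU hV s = z) ↔ _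
    have hloc := fun x => (hasOrderAt_one_iff hU e x (n x)).mp (hn x)
    choose W hxW hW f a hf ha han using hloc
    constructor
    · rintro ⟨s, rfl⟩ h0 P hP
      have hη : genericPoint X ∈ V ⊓ W P := ⟨hV, hW P⟩
      obtain ⟨c, hc⟩ := (hf P (V ⊓ W P) inf_le_right).2 (res M inf_le_left s)
      have h1 := he.quot_smul_res hU (hf P) (hW P) (ha P) inf_le_right hη c
      simp only at hc
      rw [hc, he.quot_res hU hV] at h1
      have h2 := ord_germ_nonneg hη c (x := P) ⟨hP, hxW P⟩
      change 0 ≤ Scheme.ord (germη _ hη c) P.1 at h2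
      rw [← h1, Scheme.ord_mul h0 (he.transition_ne_zero hU (hW P) (ha P)), han] at h2
      rw [hD]
      omega
    · intro hz
      by_cases h0 : z = 0
      · exact ⟨0, h0 ▸ (he.quot_eq hU hV (inf_le_left : V ⊓ U ≤ V) inf_le_right ⟨hV, hU⟩ (b := 0)
          (by rw [zero_smul, map_zero])).trans (map_zero _)⟩
      have hex : ∀ x : V, ∃ (N : X.Opens) (_ : x.1 ∈ N) (hη : genericPoint X ∈ N) (_ : N ≤ V)
          (t : Γ(M, N)), he.quot hU hη t = z := by
        rintro ⟨x, hx⟩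
        have hne := he.transition_ne_zero hU (hW x) (ha x)
        -- Near `x` the rational section `z e` is `(z a) f`, so it extends over `x` once `z a` is
        -- regular there.
        have hpos : 0 ≤ Scheme.ord (z * germη (U ⊓ W x) ⟨hU, hW x⟩ (a x)) x := by
          rw [Scheme.ord_mul h0 hne, han]
          by_cases hxη : x = genericPoint X
          · rw [hasOrderAt_eq_zero he (hn x) (Or.inr hxη), hxη, ord_genericPoint, zero_add]
          · have := hz h0 ⟨x, isClosed_of_ne_genericPoint hxη⟩ hx
            rw [hD] at this
            simp only at this
            omega
        obtain ⟨c, hc⟩ := (ord_nonneg_iff (mul_ne_zero h0 hne)).mp hpos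
        obtain ⟨N, hN, hxN, c, rfl⟩ := X.presheaf.exists_le_germ_eq c (V := V ⊓ W x) ⟨hx, hxW x⟩
        have hη := mem_of_mem hxN
        have : Nonempty N := ⟨⟨x, hxN⟩⟩
        have hc' : germη N hη c = z * germη (U ⊓ W x) ⟨hU, hW x⟩ (a x) :=
          (Scheme.algebraMap_germ_eq_germToFunctionField X hxN c).symm.trans hc
        refine ⟨N, hxN, hη, hN.trans inf_le_left, c • res M (hN.trans inf_le_right) (f x), ?_⟩
        apply mul_right_cancel₀ hne
        rw [he.quot_smul_res hU (hf x) (hW x) (ha x), hc']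
      choose N hxN hη hNV t ht using hex
      obtain ⟨s, hs⟩ := exists_res_eq_of_cover M N hNV (fun x hx => ⟨⟨x, hx⟩, hxN _⟩) t
        (fun x y => by
          have h : genericPoint X ∈ N x ⊓ N y := ⟨hη x, hη y⟩
          apply he.quot_injective hM hU h
          rw [he.quot_res hU (hη x), he.quot_res hU (hη y), ht, ht])
      refine ⟨s, ?_⟩
      let x : V := ⟨genericPoint X, hV⟩
      rw [← ht x, ← hs x, he.quot_res hU hV]

end Order

/-! ### Degrees of line bundles -/

section Degree

variable {k : Type u} [Field k] {X : Scheme.{u}} (f : X ⟶ Spec (.of k)) {M : X.Modules}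

/-- The degree of a divisor. -/
abbrev divisorDeg : (ClosedPoint X →₀ ℤ) →+ ℤ := divDeg fun P => f.residueDegree P.1

variable [IsIntegral X] [AlgebraicGeometry.IsNoetherian X] [hX : IsRegularCurve X]
  {D E : ClosedPoint X →₀ ℤ}

lemma finsum_eq_divisorDeg {n : X → ℤ} (hD : ∀ P, D P = n P.1) (hη : n (genericPoint X) = 0) :
    ∑ᶠ x, n x * (f.residueDegree x : ℤ) = divisorDeg f D := by
  have h1 : ∑ᶠ x, n x * (f.residueDegree x : ℤ) =
      ∑ᶠ x ∈ {x : X | IsClosed ({x} : Set X)}, n x * (f.residueDegree x : ℤ) := by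
    rw [← finsum_mem_univ]
    refine finsum_mem_inter_support_eq' _ _ _ fun x hx => ?_
    refine iff_of_true trivial (isClosed_of_ne_genericPoint ?_)
    rintro rfl
    rw [Function.mem_support, hη, zero_mul] at hx
    exact hx rfl
  rw [h1, ← finsum_set_coe_eq_finsum_mem, divDeg_apply, Finsupp.sum]
  have h2 := finsum_eq_sum_of_support_subset
    (fun P : ClosedPoint X => n P.1 * (f.residueDegree P.1 : ℤ)) (s := D.support) (by
      intro P hP
      rw [Finset.mem_coe, Finsupp.mem_support_iff, hD]
      exact left_ne_zero_of_mul hP)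
  refine h2.trans (Finset.sum_congr rfl fun P _ => ?_)
  rw [hD]

variable [IsProper f] [GeometricallyIntegral f]

lemma exists_trivialization (hM : IsVectorBundle M 1) {d : ℤ} (hd : HasDegree f M d) :
    ∃ D, Nonempty (RationalTrivialization M D) ∧ d = divisorDeg f D := by
  obtain ⟨r, U, hU, e, n, he, hn, rfl⟩ := hd
  obtain ⟨W, hW, e', he'⟩ := hM (genericPoint X)
  obtain rfl := he.eq_of_mem he' ⟨hU, hW⟩
  have he := isFrame_one_iff.mp he
  have hη : n (genericPoint X) = 0 := hasOrderAt_eq_zero he (hn _) (Or.inr rfl)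
  have hfin : (Function.support fun P : ClosedPoint X => n P.1).Finite := by
    refine ((finite_compl hU).subset fun x hx hxU => ?_).preimage Subtype.val_injective.injOn
      (s := Function.support n)
    exact hx (hasOrderAt_eq_zero he (hn x) (Or.inl hxU))
  refine ⟨Finsupp.ofSupportFinite _ hfin, ⟨trivializationOfGenerator (fun x => ?_) he hU _ n hn
    fun _ => rfl⟩, finsum_eq_divisorDeg f (fun _ => rfl) hη⟩
  obtain ⟨V, hx, g, hg⟩ := hM x
  exact ⟨V, hx, g 0, isFrame_one_iff.mp hg⟩

omit hX in
lemma exists_hasDegree (hM : IsVectorBundle M 1) : ∃ d, HasDegree f M d := by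
  obtain ⟨U, hU, e, he⟩ := hM (genericPoint X)
  have h : ∀ x, ∃ n, HasOrderAt M hU e x n := by
    intro x
    obtain ⟨W, hx, g, hg⟩ := hM x
    have hg := isFrame_one_iff.mp hg
    obtain ⟨a, ha⟩ := (hg (U ⊓ W) inf_le_right).2 (res M inf_le_left (e 0))
    exact ⟨_, (hasOrderAt_one_iff hU e x _).mpr ⟨W, hx, mem_of_mem hx, g 0, a, hg, ha.symm, rfl⟩⟩
  choose n hn using h
  exact ⟨_, 1, U, hU, e, n, he, hn, rfl⟩

open Classical in
lemma RationalTrivialization.hasDegree (c : RationalTrivialization M D) :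
    HasDegree f M (divisorDeg f D) := by
  obtain ⟨U, -, hU, e, -, he, -, he1⟩ := c.exists_generator (genericPoint X)
  have he1 := he1 rfl
  let n : X → ℤ := fun x => if hx : IsClosed ({x} : Set X) then D ⟨x, hx⟩ else 0
  have hn : ∀ P : ClosedPoint X, D P = n P.1 := fun P => by
    simp only [n]
    rw [dif_pos P.2]
  have hη : n (genericPoint X) = 0 := dif_neg fun h => isClosed_singleton_iff.mp h rfl
  refine ⟨1, U, hU, fun _ => e, n, isFrame_one_iff.mpr he, fun x => ?_,
    (finsum_eq_divisorDeg f hn hη).symm⟩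
  obtain ⟨W, hxW, hW, g, hg0, hg, hgP, -⟩ := c.exists_generator x
  obtain ⟨a, ha⟩ := (hg (U ⊓ W) inf_le_right).2 (res M inf_le_left e)
  refine (hasOrderAt_one_iff hU _ x _).mpr ⟨W, hxW, hW, g, a, hg, ha.symm, ?_⟩
  by_cases hx : x = genericPoint X
  · rw [hx, hη]
    exact ord_genericPoint _
  have hη : genericPoint X ∈ U ⊓ W := ⟨hU, hW⟩
  -- Since `e` has coordinate `1`, the transition function is the inverse of the coordinate of `g`,
  -- which has order `-D`.
  have h1 := congrArg (c.coord (U ⊓ W) hη) ha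
  simp only [c.coord_smul, c.coord_res] at h1
  rw [he1] at h1
  have h2 := hgP ⟨x, isClosed_of_ne_genericPoint hx⟩ hxW
  have h3 : Scheme.ord (germη (U ⊓ W) hη a) x = n x := by
    rw [eq_inv_of_mul_eq_one_left h1, ord_inv hg0, ← hn ⟨x, isClosed_of_ne_genericPoint hx⟩, h2,
      neg_neg]
  exact h3

omit [IsProper f] [GeometricallyIntegral f] in
lemma principal_eq_div {z : X.functionField} (hz : z ≠ 0) :
    principal z hz = (curveOrd f).div z hz := by
  ext P
  rfl

-- Divisors of the same bundle differ by a principal divisor, which has degree zero.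
omit [GeometricallyIntegral f] in
lemma RationalTrivialization.divisorDeg_eq (c : RationalTrivialization M D)
    (c' : RationalTrivialization M E) : divisorDeg f E = divisorDeg f D := by
  obtain ⟨φ, hφ, rfl, -⟩ := c.exists_coord_eq_mul c'
  have h := (isProperFamily_curveOrd f).divDeg_div (x := φ) hφ
  rw [map_sub, principal_eq_div f hφ, h, sub_zero]

/-- `degree` selects an arbitrary witness. Each witness comes from a trivialization by some divisor,
and all such divisors have the same degree. -/
theorem RationalTrivialization.degree_eq (c : RationalTrivialization M D) :
    degree f M = divisorDeg f D := by
  have h : ∃ d, HasDegree f M d := ⟨_, c.hasDegree f⟩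
  rw [degree, dif_pos h]
  obtain ⟨E, ⟨c'⟩, hE⟩ := exists_trivialization f c.isVectorBundle h.choose_spec
  rw [hE]
  exact c.divisorDeg_eq f c'

end Degree

/-! ### Sections and automorphisms of line bundles -/

section Count

variable {k : Type u} [Field k] {X : Scheme.{u}} (f : X ⟶ Spec (.of k)) {M : X.Modules}
  [IsIntegral X] [AlgebraicGeometry.IsNoetherian X] [hX : IsRegularCurve X]
  {D : ClosedPoint X →₀ ℤ}

lemma isRegularOn_top_iff {z : X.functionField} :
    IsRegularOn D ⊤ z ↔ (show FunctionField f from z) ∈ (curveOrd f).space D := by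
  rw [OrdFamily.mem_space]
  exact forall₂_congr fun _ P => ⟨fun h => h trivial, fun h _ => h⟩

/-- Global sections as rational functions. -/
def RationalTrivialization.globalSectionsEquiv (c : RationalTrivialization M D) :
    letI : Module k Γ(M, ⊤) := Module.compHom Γ(M, ⊤) (baseHom f).hom
    Γ(M, ⊤) ≃ₗ[k] (curveOrd f).space D :=
  letI : Module k Γ(M, ⊤) := Module.compHom Γ(M, ⊤) (baseHom f).hom
  let l : Γ(M, ⊤) →ₗ[k] (curveOrd f).space D :=
    { toFun := fun s => ⟨c.coord ⊤ trivial s,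
        (isRegularOn_top_iff f).mp (c.isRegularOn_coord (U := ⊤) trivial s)⟩
      map_add' := fun s t => Subtype.ext (map_add (c.coord ⊤ trivial) s t)
      map_smul' := fun a s => Subtype.ext ((c.coord_smul ⊤ trivial _ s).trans
        (Algebra.smul_def (A := FunctionField f) a _).symm) }
  LinearEquiv.ofBijective l
    ⟨fun s t h => c.coord_injective ⊤ trivial (congrArg Subtype.val h), fun z => by
      obtain ⟨s, hs⟩ := c.exists_coord_eq (U := ⊤) trivial ((isRegularOn_top_iff f).mpr z.2)
      exact ⟨s, Subtype.ext hs⟩⟩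

theorem RationalTrivialization.h0_eq (c : RationalTrivialization M D) :
    h0 f M = Module.finrank k ((curveOrd f).space D) :=
  letI : Module k Γ(M, ⊤) := Module.compHom Γ(M, ⊤) (baseHom f).hom
  (c.globalSectionsEquiv f).finrank_eq

/-- Composing `c` with an automorphism gives another trivialization with the same `D`. The two are
proportional, and the factor has trivial divisor; conversely every such factor acts on `M`. -/
theorem RationalTrivialization.card_aut (c : RationalTrivialization M D) :
    Nat.card (Aut M) = Nat.card (curveOrd f).units := by
  have hex : ∀ α : Aut M, ∃ φ : (curveOrd f).units, ∀ U hU s,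
      c.coord U hU (α.hom.app U s) = (show X.functionField from φ.1) * c.coord U hU s := by
    intro α
    obtain ⟨φ, hφ, h, hα⟩ := c.exists_coord_eq_mul (c.congr α)
    refine ⟨⟨φ, hφ, fun P => ?_⟩, hα⟩
    have h := DFunLike.congr_fun h P
    rw [Finsupp.sub_apply, principal_apply] at h
    change Scheme.ord φ P.1 = 0
    omega
  choose Φ hΦ using hex
  refine Nat.card_congr (Equiv.ofBijective Φ ⟨fun α β h => ?_, fun φ => ?_⟩)
  · refine Iso.ext (Scheme.Modules.hom_ext _ _ fun U => ?_)
    ext s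
    by_cases hU : genericPoint X ∈ U
    · apply c.coord_injective U hU
      rw [hΦ, hΦ, h]
    · have := subsingleton_of_notMem M hU
      exact Subsingleton.elim _ _
  · obtain ⟨φ, hφ0, hφ⟩ := φ
    have hD : principal (X := X) φ hφ0 = 0 := Finsupp.ext hφ
    obtain ⟨α, hα⟩ := c.exists_iso hφ0 (by rw [hD, sub_zero]) c
    refine ⟨α, Subtype.ext ?_⟩
    obtain ⟨U, -, hU, e, he, -⟩ := c.exists_generator (genericPoint X)
    exact mul_right_cancel₀ (M₀ := X.functionField) he ((hΦ α U hU e).symm.trans (hα U hU e))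

end Count

/-! ### Comparison of the zeta functions -/

section Comparison

variable {k : Type u} [Field k] {X : Scheme.{u}} (f : X ⟶ Spec (.of k)) {M : X.Modules}
  [IsIntegral X] [AlgebraicGeometry.IsNoetherian X]

/-- An effective divisor as a divisor. -/
def EffectiveDivisor.toDivisor (E : EffectiveDivisor X) : ClosedPoint X →₀ ℤ :=
  E.mapRange (fun n : ℕ => (n : ℤ)) rfl

omit [IsIntegral X] [AlgebraicGeometry.IsNoetherian X] in
lemma EffectiveDivisor.toDivisor_apply (E : EffectiveDivisor X) (P : ClosedPoint X) :
    E.toDivisor P = E P := rfl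

omit [IsIntegral X] [AlgebraicGeometry.IsNoetherian X] in
lemma EffectiveDivisor.divisorDeg_toDivisor (E : EffectiveDivisor X) :
    divisorDeg f E.toDivisor = divisorDegree f E := by
  rw [divDeg_apply, toDivisor, Finsupp.sum_mapRange_index (by simp), divisorDegree, Finsupp.sum,
    Finsupp.sum]
  push_cast
  rfl

omit [IsIntegral X] [AlgebraicGeometry.IsNoetherian X] in
lemma artinZetaTerm_eq (s : ℂ) (E : EffectiveDivisor X) :
    artinZetaTerm f s E = ((Nat.card k : ℂ) ^ (-s)) ^ divisorDegree f E := by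
  have h : ∀ n : ℕ, (((Nat.card k ^ n : ℕ)) : ℂ) ^ s = ((Nat.card k : ℂ) ^ s) ^ n := by
    intro n
    induction n with
    | zero => simp
    | succ n ih => rw [pow_succ, Nat.cast_mul, Complex.natCast_mul_natCast_cpow, ih, pow_succ]
  rw [artinZetaTerm, divisorNorm, h, Complex.cpow_neg, inv_pow, one_div]

variable [hX : IsRegularCurve X]

theorem summable_artinZetaTerm [Finite k] [IsProper f] {s : ℂ} (hs : 1 < s.re) :
    Summable fun E : EffectiveDivisor X => artinZetaTerm f s E := by
  have hq : 2 ≤ Nat.card k := Finite.one_lt_card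
  have hq0 : (0 : ℝ) < Nat.card k := by positivity
  have hv := isProperFamily_curveOrd f
  obtain ⟨B, hB⟩ := hv.exists_card_le
  refine Summable.of_norm ?_
  -- With `r = q ^ (-Re s)`, the condition `q r < 1` is `Re s > 1`.
  have h := summable_pow_degree (fun P : ClosedPoint X => f.residueDegree P.1) B (Nat.card k)
    hv.deg_pos hq hB (r := (Nat.card k : ℝ) ^ (-s.re)) (by positivity) (by
      rw [← Real.rpow_one_add' hq0.le (by linarith)]
      exact Real.rpow_lt_one_of_one_lt_of_neg (by exact_mod_cast hq) (by linarith))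
  refine h.congr fun E => ?_
  rw [artinZetaTerm_eq, norm_pow, Complex.norm_natCast_cpow_of_pos (by omega), Complex.neg_re]
  rfl

variable {D : ClosedPoint X →₀ ℤ}

/-- Isomorphisms of divisor line bundles are multiplications by rational functions, which change the
divisor by a principal one. -/
lemma RationalTrivialization.nonempty_iso_iff (c : RationalTrivialization M D)
    (E : EffectiveDivisor X) :
    Nonempty (lineBundle E.toDivisor ≅ M) ↔ E ∈ (curveOrd f).linearSystem D := by
  constructor
  · rintro ⟨α⟩
    obtain ⟨φ, hφ, h, -⟩ := c.exists_coord_eq_mul ((lineBundleTrivialization _).congr α.symm)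
    refine ⟨_, inv_ne_zero hφ, fun P => ?_⟩
    have h := DFunLike.congr_fun h P
    rw [Finsupp.sub_apply, principal_apply, E.toDivisor_apply] at h
    rw [h, sub_eq_add_neg, ← ord_inv hφ]
    rfl
  · rintro ⟨φ, hφ, h⟩
    obtain ⟨α, -⟩ := (lineBundleTrivialization E.toDivisor).exists_iso (X := X) (φ := φ) hφ
      (E := D) (by
        ext P
        exact eq_sub_of_add_eq (h P).symm) c
    exact ⟨α⟩

lemma divisorDeg_of_mem_linearSystem [IsProper f] {E : EffectiveDivisor X}
    (hE : E ∈ (curveOrd f).linearSystem D) : (divisorDegree f E : ℤ) = divisorDeg f D := by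
  obtain ⟨φ, hφ, h⟩ := hE
  have h' : E.toDivisor = D + (curveOrd f).div φ hφ := by
    ext P
    exact h P
  rw [← E.divisorDeg_toDivisor, h', map_add, (isProperFamily_curveOrd f).divDeg_div, add_zero]

variable [GeometricallyIntegral f]

theorem RationalTrivialization.nonabelianZetaTerm_eq [Finite k] [IsProper f]
    (c : RationalTrivialization M D) (s : ℂ) : nonabelianZetaTerm f s M =
      Nat.card ((curveOrd f).linearSystem D) * ((Nat.card k : ℂ) ^ (-s)) ^ divisorDeg f D := by
  have hv := isProperFamily_curveOrd f
  have := hv.finite_coe_space D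
  have h1 : Nat.card k ^ h0 f M = Nat.card ((curveOrd f).space D) := by
    have := hv.finite_space D
    rw [c.h0_eq f, Module.natCard_eq_pow_finrank (K := k) (V := (curveOrd f).space D)]
  have h2 := (hv.card_linearSystem_mul D).2
  have h3 : (Nat.card (curveOrd f).units : ℂ) ≠ 0 := by
    exact_mod_cast hv.card_units_pos.ne'
  have h4 : 1 ≤ Nat.card ((curveOrd f).space D) := Nat.card_pos
  rw [nonabelianZetaTerm, c.degree_eq f, c.card_aut f]
  congr 1
  rw [div_eq_iff h3, ← Nat.cast_pow, h1, ← Nat.cast_mul, h2, Nat.cast_sub h4, Nat.cast_one]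

omit [IsIntegral X] [AlgebraicGeometry.IsNoetherian X] hX in
lemma mem_semistableClasses_one_iff [IsProper f] (c : Quotient (isIsomorphicSetoid X.Modules)) :
    c ∈ semistableClasses f 1 ↔ IsVectorBundle c.out 1 ∧ 0 ≤ degree f c.out := by
  refine and_congr_left fun _ => ⟨And.left, fun h => ⟨h, fun V' i r' _ h1 h2 => by omega⟩⟩

/-- The class of the line bundle of an effective divisor. -/
def classOfEffectiveDivisor [IsProper f] (E : EffectiveDivisor X) : semistableClasses f 1 :=
  ⟨Quotient.mk (isIsomorphicSetoid X.Modules) (lineBundle E.toDivisor), by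
    obtain ⟨α⟩ : IsIsomorphic
        (Quotient.mk (isIsomorphicSetoid X.Modules) (lineBundle E.toDivisor)).out
        (lineBundle E.toDivisor) := Quotient.mk_out (s := isIsomorphicSetoid X.Modules) _
    let c := (lineBundleTrivialization E.toDivisor).congr α
    rw [mem_semistableClasses_one_iff, c.degree_eq f, E.divisorDeg_toDivisor]
    exact ⟨c.isVectorBundle, Int.natCast_nonneg _⟩⟩

lemma classOfEffectiveDivisor_eq_iff [IsProper f] (E : EffectiveDivisor X)
    (c : semistableClasses f 1) :
    classOfEffectiveDivisor f E = c ↔ Nonempty (lineBundle E.toDivisor ≅ c.1.out) := by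
  rw [Subtype.ext_iff]
  exact Quotient.mk_eq_iff_out (s := isIsomorphicSetoid X.Modules)

/-- The fibre is the linear system of a divisor of the bundle, and the Artin term is constant on it
because the degree is. If the bundle has no nonzero section, the fibre is empty and both sides
vanish. -/
theorem tsum_fiber_artinZetaTerm [Finite k] [IsProper f] (s : ℂ) (c : semistableClasses f 1) :
    ∑' E : {E // classOfEffectiveDivisor f E = c}, artinZetaTerm f s E =
      nonabelianZetaTerm f s c.1.out := by
  have hc := ((mem_semistableClasses_one_iff f c.1).mp c.2).1
  obtain ⟨d, hd⟩ := exists_hasDegree f hc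
  obtain ⟨D, ⟨t⟩, -⟩ := exists_trivialization f hc hd
  have hmem : ∀ E, classOfEffectiveDivisor f E = c ↔ E ∈ (curveOrd f).linearSystem D := fun E =>
    (classOfEffectiveDivisor_eq_iff f E c).trans (t.nonempty_iso_iff f E)
  have h : ∀ E : {E // classOfEffectiveDivisor f E = c},
      artinZetaTerm f s E = ((Nat.card k : ℂ) ^ (-s)) ^ divisorDeg f D := fun E => by
    rw [artinZetaTerm_eq, ← zpow_natCast, divisorDeg_of_mem_linearSystem f ((hmem E).mp E.2)]
  rw [tsum_congr h, tsum_const, t.nonabelianZetaTerm_eq f, nsmul_eq_mul,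
    Nat.card_congr (Equiv.subtypeEquivRight hmem)]

end Comparison

lemma isNoetherian_of_isCurve {k : Type u} [Field k] {X : Scheme.{u}} (f : X ⟶ Spec (.of k))
    [IsCurve f] : AlgebraicGeometry.IsNoetherian X where
  toIsLocallyNoetherian := isLocallyNoetherian_of_locallyOfFiniteType f
  toCompactSpace := QuasiCompact.compactSpace_of_compactSpace f

end CurveZeta

end

theorem mainTheorem5 {k : Type u} [Field k] [Finite k] {C : Scheme.{u}} (f : C ⟶ Spec (.of k))
    [CurveZeta.IsCurve f] (s : ℂ) (hs : 1 < s.re) :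
    (Summable fun c : CurveZeta.semistableClasses f 1 =>
      CurveZeta.nonabelianZetaTerm f s c.1.out) ∧
    (Summable fun D : CurveZeta.EffectiveDivisor C => CurveZeta.artinZetaTerm f s D) ∧
    CurveZeta.nonabelianZeta f 1 s = CurveZeta.artinZeta f s := by
  have := CurveZeta.isIntegral_of_geometricallyIntegral f
  have := CurveZeta.isNoetherian_of_isCurve f
  have : CurveZeta.IsRegularCurve C :=
    ⟨CurveZeta.IsCurve.isRegularLocalRing_stalk f, CurveZeta.IsCurve.topologicalKrullDim_eq_one f⟩
  have h := CurveZeta.summable_artinZetaTerm f hs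
  -- Regrouping the summable Artin series by the class of `𝒪(E)` gives both the summability of the
  -- fibre sums and the equality.
  let e := Equiv.sigmaFiberEquiv (CurveZeta.classOfEffectiveDivisor f)
  have h' := e.summable_iff.mpr h
  refine ⟨?_, h, ?_⟩
  · exact h'.sigma.congr fun c => CurveZeta.tsum_fiber_artinZetaTerm f s c
  · rw [CurveZeta.nonabelianZeta, CurveZeta.artinZeta, ← e.tsum_eq]
    refine Eq.trans ?_ h'.tsum_sigma.symm
    exact tsum_congr fun c => (CurveZeta.tsum_fiber_artinZetaTerm f s c).symm
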